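/- Let $R$ be a commutative ring and $s\in R$ a regular element (a non-zero-divisor). A module homomorphism $f\colon F\to M$ is called a flat cover if $F$ is a flat $R$-module, every homomorphism $F'\to M$ from a flat $R$-module $F'$ factors through $f$, and every endomorphism $h$ of $F$ with $fh=f$ is an automorphism. Suppose that the class $\mathcal{D}_s=\{M\in \mathrm{Mod}\text{-}R \mid M=sM\}$ of all $s$-divisible $R$-modules is closed under flat covers, i.e. for every flat cover $F\to M$ with $M\in\mathcal{D}_s$ we have $F\in\mathcal{D}_s$. Then the ring $\bar R:=R/sR$ has the following property: (P) every countably presented flat $\bar R$-module admits a filtration by ideals of $\bar R$. Here an $\bar R$-module $M$ is countably presented if there is an exact sequence $\bar R^{(J)}\to\bar R^{(I)}\to M\to 0$ with $I$ and $J$ countable, and a filtration of $M$ by ideals of $\bar R$ is a family $(M_\alpha)_{\alpha<\lambda}$ of submodules of $M$, indexed by the ordinals smaller than some ordinal $\lambda$, such that $M_0=0$, $M_\alpha\subseteq M_\beta$ whenever $\alpha\le\beta<\lambda$, $M_\beta=\bigcup_{\alpha<\beta}M_\alpha$ for every limit ordinal $\beta<\lambda$, $M=\bigcup_{\alpha<\lambda}M_\alpha$,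 and for every $\alpha$ with $\alpha+1<\lambda$ the factor $M_{\alpha+1}/M_\alpha$ is isomorphic, as an $\bar R$-module, to an ideal of $\bar R$. -/

import Mathlib

universe u

/-- `f : F → M` is a flat precover: `F` is flat, and every map from a flat module to `M`
factors through `f`. -/
structure IsFlatPrecover {R : Type u} [CommRing R] {F M : Type u}
    [AddCommGroup F] [Module R F] [AddCommGroup M] [Module R M] (f : F →ₗ[R] M) : Prop where
  flat : Module.Flat R F
  exists_factorization : ∀ (F' : Type u) [AddCommGroup F'] [Module R F'] [Module.Flat R F']
    (g : F' →ₗ[R] M), ∃ h : F' →ₗ[R] F, f ∘ₗ h = g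

/-- `f : F → M` is a flat cover: a flat precover such that every endomorphism `h` of `F`
with `f ∘ h = f` is an automorphism. -/
structure IsFlatCover {R : Type u} [CommRing R] {F M : Type u}
    [AddCommGroup F] [Module R F] [AddCommGroup M] [Module R M] (f : F →ₗ[R] M) : Prop
    extends IsFlatPrecover f where
  bijective_of_comp_eq : ∀ h : F →ₗ[R] F, f ∘ₗ h = f → Function.Bijective h

/-- `M` is `s`-divisible: `M = sM`. -/
def IsElementDivisible {R : Type u} [CommRing R] (s : R) (M : Type u)
    [AddCommGroup M] [Module R M] : Prop :=
  ∀ m : M, ∃ n : M, s • n = m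

/-- The class of `s`-divisible `R`-modules is closed under flat covers: the domain of every flat
cover of an `s`-divisible module is `s`-divisible. -/
def DivisibleClosedUnderFlatCovers {R : Type u} [CommRing R] (s : R) : Prop :=
  ∀ (F M : Type u) [AddCommGroup F] [Module R F] [AddCommGroup M] [Module R M]
    (f : F →ₗ[R] M), IsFlatCover f → IsElementDivisible s M → IsElementDivisible s F

/-- `M` is countably presented: there is an exact sequence `R^(J) → R^(I) → M → 0`
with `I` and `J` countable. -/
def IsCountablyPresented (R : Type u) [CommRing R] (M : Type u)
    [AddCommGroup M] [Module R M] : Prop :=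
  ∃ (I J : Type) (_ : Countable I) (_ : Countable J)
    (g : (J →₀ R) →ₗ[R] (I →₀ R)) (p : (I →₀ R) →ₗ[R] M),
    Function.Exact g p ∧ Function.Surjective p

/-- `(N α)_{α < lam}` is a filtration of `M`: an increasing continuous sequence of submodules
starting at `0` with union `M`. Only the values `N α` with `α < lam` matter. -/
structure IsOrdinalFiltration {R : Type u} [CommRing R] {M : Type u}
    [AddCommGroup M] [Module R M] (lam : Ordinal.{u}) (N : Ordinal.{u} → Submodule R M) :
    Prop where
  zero : N 0 = ⊥
  mono : ∀ α β : Ordinal.{u}, α ≤ β → β < lam → N α ≤ N β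
  continuous : ∀ β : Ordinal.{u}, β < lam → Order.IsSuccLimit β →
    (N β : Set M) = ⋃ α ∈ Set.Iio β, (N α : Set M)
  union : ⋃ α ∈ Set.Iio lam, (N α : Set M) = Set.univ

/-- `M` is filtered by ideals of `R`: it has a filtration each of whose consecutive factors is
isomorphic, as an `R`-module, to an ideal of `R`. -/
def IsFilteredByIdeals (R : Type u) [CommRing R] (M : Type u)
    [AddCommGroup M] [Module R M] : Prop :=
  ∃ (lam : Ordinal.{u}) (N : Ordinal.{u} → Submodule R M), IsOrdinalFiltration lam N ∧
    ∀ α : Ordinal.{u}, Order.succ α < lam →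
      ∃ I : Ideal R,
        Nonempty ((N (Order.succ α) ⧸ (N α).submoduleOf (N (Order.succ α))) ≃ₗ[R] I)

/-- Property (P) of a ring: every countably presented flat module is filtered by ideals. -/
def PropertyP (R : Type u) [CommRing R] : Prop :=
  ∀ (M : Type u) [AddCommGroup M] [Module R M],
    IsCountablyPresented R M → Module.Flat R M → IsFilteredByIdeals R M

/-! A countably presented flat module N over R/sR is embedded in a module Q filtered with factors
R/sR; intersecting that filtration with N leaves ideals as factors.

N is a direct limit of a sequence of free modules whose transition maps lift to R, so N ≅ G/sG with
G flat over R (`exists_flat_lift`). Adjoining formal s-th roots embeds G in an s-divisible M such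
that Q = M/G has the required filtration (`exists_divisible_extension`). Let f : F → M be a flat
cover. By hypothesis F is s-divisible, and s is injective on the flat module F, so s acts
bijectively on F. The embedding G → M lifts to e : G → F, and x ↦ f(s⁻¹ e x) mod G is a map G → Q.
It vanishes at x exactly when f(s⁻¹ e x) is some y in G, that is, when x = s y. Its kernel is sG, so
N embeds in Q.

The existence of flat covers is proved on the way. A flat module over M may be divided by a maximal
pure submodule of the kernel; the resulting modules are all quotients of one free module, so one
direct sum is a precover (`exists_isFlatPrecover`). Transfinite chains of copies of a precover, long
compared with its size, then yield a precover whose endomorphisms over M are injective, and show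
that these are also surjective. -/

open Module

/-! ### Purity and flat quotients -/

/-- A submodule `P` of `F` is pure if every finite linear combination of elements of `F` lying in
`P` can be rewritten, with the same coefficients, as a combination of elements of `P`. -/
def IsPureSub {R F : Type*} [CommRing R] [AddCommGroup F] [Module R F] (P : Submodule R F) : Prop :=
  ∀ (n : ℕ) (r : Fin n → R) (x : Fin n → F), ∑ i, r i • x i ∈ P →
    ∃ y : Fin n → F, (∀ i, y i ∈ P) ∧ ∑ i, r i • y i = ∑ i, r i • x i

section Pure

variable {R F : Type*} [CommRing R] [AddCommGroup F] [Module R F]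

/-- Single equations suffice in the definition of purity because `F` is flat: purity corrects a
lifted relation by elements of `P` to a true relation in `F`, and the equational criterion
trivialises it. -/
theorem flat_quotient_of_isPureSub [Flat R F] {P : Submodule R F} (hP : IsPureSub P) :
    Flat R (F ⧸ P) := by
  refine Flat.of_forall_isTrivialRelation fun {l f x} h => ?_
  choose x' hx' using fun i => P.mkQ_surjective (x i)
  obtain rfl : (fun i => P.mkQ (x' i)) = x := funext hx'
  have h1 : ∑ i, f i • x' i ∈ P := by
    rw [← P.ker_mkQ, LinearMap.mem_ker]; simpa using h
  obtain ⟨y, hyP, hy⟩ := hP _ f x' h1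
  have h2 : ∑ i, f i • (x' i - y i) = 0 := by
    simp [smul_sub, Finset.sum_sub_distrib, hy]
  obtain ⟨k, a, z, hz, ha⟩ := Flat.isTrivialRelation_of_sum_smul_eq_zero h2
  refine ⟨k, a, fun j => P.mkQ (z j), fun i => ?_, ha⟩
  have := congrArg P.mkQ (hz i)
  have h3 : P.mkQ (y i) = 0 := by
    rw [← LinearMap.mem_ker, P.ker_mkQ]; exact hyP i
  rw [map_sub, h3, sub_zero] at this
  simp only [this, map_sum, map_smul]

/-- A trivialisation of the relation in the quotient lifts to `F`; subtracting the lifted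
combinations moves each `x i` into `P` and leaves the sum unchanged. -/
theorem isPureSub_of_flat_quotient {P : Submodule R F} (hP : Flat R (F ⧸ P)) : IsPureSub P := by
  intro n r x h
  have h1 : ∑ i, r i • P.mkQ (x i) = 0 := by
    have := h
    rw [← P.ker_mkQ, LinearMap.mem_ker] at this; simpa using this
  obtain ⟨k, a, z, hz, ha⟩ := Flat.isTrivialRelation_of_sum_smul_eq_zero h1
  choose z' hz' using fun i => P.mkQ_surjective (z i)
  obtain rfl : (fun i => P.mkQ (z' i)) = z := funext hz'
  refine ⟨fun i => x i - ∑ j, a i j • z' j, fun i => ?_, ?_⟩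
  · rw [← P.ker_mkQ, LinearMap.mem_ker, map_sub, sub_eq_zero]
    refine (hz i).trans ?_
    simp
  · have : ∑ i, r i • ∑ j, a i j • z' j = 0 := by
      simp_rw [Finset.smul_sum, smul_smul]
      rw [Finset.sum_comm]
      simp_rw [← Finset.sum_smul, ha]
      simp
    simp [smul_sub, Finset.sum_sub_distrib, this]

theorem isPureSub_bot : IsPureSub (⊥ : Submodule R F) := by
  intro n r x h
  refine ⟨0, by simp, ?_⟩
  rw [Submodule.mem_bot] at h
  simp [h]

theorem isPureSub_sSup {c : Set (Submodule R F)} (hne : c.Nonempty) (hc : DirectedOn (· ≤ ·) c)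
    (h : ∀ P ∈ c, IsPureSub P) : IsPureSub (sSup c) := by
  intro n r x hx
  obtain ⟨P, hP, hx⟩ := (Submodule.mem_sSup_of_directed hne hc).1 hx
  obtain ⟨y, hy, e⟩ := h P hP n r x hx
  exact ⟨y, fun i => le_sSup hP (hy i), e⟩

/-- Every flat module over `M` has a flat quotient over `M` whose kernel contains no nonzero pure
submodule. -/
theorem exists_reduced_quotient [Flat R F] {M : Type*} [AddCommGroup M] [Module R M]
    (f : F →ₗ[R] M) : ∃ P : Submodule R F, ∃ hP : P ≤ LinearMap.ker f, IsPureSub P ∧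
      ∀ Q : Submodule R (F ⧸ P), IsPureSub Q → Q ≤ LinearMap.ker (P.liftQ f hP) → Q = ⊥ := by
  obtain ⟨P, -, hP⟩ := zorn_le_nonempty₀ {P : Submodule R F | IsPureSub P ∧ P ≤ LinearMap.ker f}
    (fun c hcs hc y hy => ⟨sSup c, ⟨isPureSub_sSup ⟨y, hy⟩ hc.directedOn fun P hP => (hcs hP).1,
      sSup_le fun P hP => (hcs hP).2⟩, fun z hz => le_sSup hz⟩) ⊥ ⟨isPureSub_bot, bot_le⟩
  refine ⟨P, hP.prop.2, hP.prop.1, fun Q hQ hQf => ?_⟩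
  have := flat_quotient_of_isPureSub hP.prop.1
  have hle : P ≤ Q.comap P.mkQ := by
    intro x hx
    have : P.mkQ x = 0 := by rwa [← LinearMap.mem_ker, P.ker_mkQ]
    simp only [Submodule.mem_comap, this, Q.zero_mem]
  -- The quotient of `F` by the preimage of `Q` is (F/P)/Q, which is flat; so the preimage is pure
  -- and maximality of `P` applies to it.
  have hmem : Q.comap P.mkQ ∈ {P : Submodule R F | IsPureSub P ∧ P ≤ LinearMap.ker f} := by
    constructor
    · apply isPureSub_of_flat_quotient
      have := flat_quotient_of_isPureSub hQ
      have e := Submodule.quotientQuotientEquivQuotient P (Q.comap P.mkQ) hle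
      rw [Submodule.map_comap_eq_of_surjective P.mkQ_surjective] at e
      exact Flat.of_linearEquiv e.symm
    · intro x hx
      have := hQf hx
      simpa using this
  have heq := le_antisymm (hP.le_of_ge hmem hle) hle
  rw [eq_bot_iff]
  intro q hq
  obtain ⟨x, rfl⟩ := P.mkQ_surjective q
  have : x ∈ P := heq ▸ hq
  rw [← P.ker_mkQ] at this
  exact this

end Pure

/-! ### Small submodules with pure sum -/

section Small

universe v

variable {R F : Type v} [CommRing R] [AddCommGroup F] [Module R F]

open Cardinal

/-- Downward Löwenheim-Skolem: a small set is contained in a small submodule whose sum with a given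
pure submodule is pure. -/
theorem exists_small_sup_isPureSub {Z : Submodule R F} (hZ : IsPureSub Z) {κ : Cardinal.{v}}
    (hκ : ℵ₀ ≤ κ) (hR : #R ≤ κ) (X : Set F) (hX : #X ≤ κ) :
    ∃ A : Submodule R F, X ⊆ A ∧ #A ≤ κ ∧ IsPureSub (A ⊔ Z) := by
  classical
  -- Terms are built from elements of `X` by sums, scalar multiples and coordinates of a chosen
  -- solution of a linear equation modulo `Z`; their values form the required submodule.
  let α : Type v := X ⊕ (Unit ⊕ (R ⊕ (Σ n : ℕ, (Fin n → R) × Fin n)))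
  let β : α → Type v := Sum.elim (fun _ => PEmpty) (Sum.elim (fun _ => ULift Bool)
    (fun _ => PUnit))
  have : ∀ a, Finite (β a) := by
    rintro (a | a | a) <;> dsimp [β] <;> infer_instance
  let Wit (n : ℕ) (r : Fin n → R) (a : F) : Prop :=
    ∃ x : Fin n → F, ∃ z ∈ Z, a + z = ∑ i, r i • x i
  let wit (n : ℕ) (r : Fin n → R) (a : F) (i : Fin n) : F :=
    if h : Wit n r a then h.choose i else 0
  let step : (Σ a, β a → F) → F := fun p => match p with
    | ⟨.inl x, _⟩ => x
    | ⟨.inr (.inl _), d⟩ => d ⟨true⟩ + d ⟨false⟩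
    | ⟨.inr (.inr (.inl r)), d⟩ => r • d ⟨⟩
    | ⟨.inr (.inr (.inr t)), d⟩ => wit t.1 t.2.1 (d ⟨⟩) t.2.2
  let ev : WType β → F := WType.elim F step
  have hadd : ∀ a ∈ Set.range ev, ∀ b ∈ Set.range ev, a + b ∈ Set.range ev := by
    rintro _ ⟨a, rfl⟩ _ ⟨b, rfl⟩
    exact ⟨WType.mk (.inr (.inl ())) fun t => bif t.down then a else b, rfl⟩
  have hsmul : ∀ (r : R), ∀ a ∈ Set.range ev, r • a ∈ Set.range ev := by
    rintro r _ ⟨a, rfl⟩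
    exact ⟨WType.mk (.inr (.inr (.inl r))) fun _ => a, rfl⟩
  have hwit : ∀ n r i, ∀ a ∈ Set.range ev, wit n r a i ∈ Set.range ev := by
    rintro n r i _ ⟨a, rfl⟩
    exact ⟨WType.mk (.inr (.inr (.inr ⟨n, r, i⟩))) fun _ => a, rfl⟩
  have hXev : X ⊆ Set.range ev := fun x hx => ⟨WType.mk (.inl ⟨x, hx⟩) PEmpty.elim, rfl⟩
  have hcard : #(Set.range ev) ≤ κ := by
    refine mk_range_le.trans (WType.cardinalMk_le_max_aleph0_of_finite.trans (max_le ?_ hκ))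
    have h4 : #(Σ n : ℕ, (Fin n → R) × Fin n) ≤ κ := by
      let j : (Σ n : ℕ, (Fin n → R) × Fin n) → List R × ℕ := fun t => (List.ofFn t.2.1, t.2.2)
      have hj : Function.Injective j := by
        rintro ⟨n, r, i⟩ ⟨m, r', i'⟩ h
        simp only [j, Prod.mk.injEq] at h
        obtain ⟨h1, h2⟩ := h
        have h3 := List.ofFn_inj'.1 h1
        obtain rfl : n = m := congrArg Sigma.fst h3
        obtain rfl : r = r' := by simpa using h3
        obtain rfl : i = i' := Fin.ext h2
        rfl
      refine (mk_le_of_injective hj).trans ?_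
      rw [mk_prod]
      refine (mul_le_mul' (a := lift #(List R)) (b := κ) (c := lift #ℕ) (d := κ) ?_ ?_).trans
        (mul_eq_self hκ).le
      · simpa using (mk_list_le_max R).trans (max_le hκ hR)
      · simpa using hκ
    simp only [α, mk_sum, lift_id, lift_uzero]
    have : (lift.{v} #Unit) ≤ κ := by
      simpa using one_le_aleph0.trans hκ
    exact add_le_of_le hκ hX (add_le_of_le hκ (by simpa using this) (add_le_of_le hκ hR h4))
  by_cases hne : X.Nonempty
  swap
  -- Without elements of `X` there are no nullary constructors, hence no terms at all, not even one
  -- for zero.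
  · rw [Set.not_nonempty_iff_eq_empty] at hne
    refine ⟨⊥, by simp [hne], ?_, by simpa using hZ⟩
    simpa using one_le_aleph0.trans hκ
  obtain ⟨x0, hx0⟩ := hne
  let A : Submodule R F :=
    { carrier := Set.range ev
      add_mem' := fun {a b} ha hb => hadd a ha b hb
      zero_mem' := by simpa using hsmul 0 x0 (hXev hx0)
      smul_mem' := fun r a ha => hsmul r a ha }
  refine ⟨A, hXev, hcard, ?_⟩
  intro n r x hx
  obtain ⟨a, ha, z, hz, haz⟩ := Submodule.mem_sup.1 hx
  have hW : Wit n r a := ⟨x, z, hz, haz⟩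
  obtain ⟨z', hz', hW'⟩ := hW.choose_spec
  have hmem : ∀ i, hW.choose i ∈ A := by
    intro i
    have := hwit n r i a ha
    simp only [wit, dif_pos hW] at this
    exact this
  -- The chosen solution is right only modulo `Z`; purity of `Z` supplies the correction.
  have hd : ∑ i, r i • (x i - hW.choose i) ∈ Z := by
    have : ∑ i, r i • (x i - hW.choose i) = z - z' := by
      simp only [smul_sub, Finset.sum_sub_distrib, ← hW', ← haz]; abel
    rw [this]; exact Z.sub_mem hz hz'
  obtain ⟨y, hy, hyd⟩ := hZ _ _ _ hd
  refine ⟨fun i => hW.choose i + y i, fun i => Submodule.add_mem_sup (hmem i) (hy i), ?_⟩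
  simp only [smul_add, Finset.sum_add_distrib, hyd, smul_sub, Finset.sum_sub_distrib]
  abel

end Small

theorem exists_comp_eq_of_ker_le {R A B C : Type*} [Ring R] [AddCommGroup A] [Module R A]
    [AddCommGroup B] [Module R B] [AddCommGroup C] [Module R C] (q : A →ₗ[R] B)
    (hq : Function.Surjective q) (g : A →ₗ[R] C) (h : LinearMap.ker q ≤ LinearMap.ker g) :
    ∃ φ : B →ₗ[R] C, ∀ a, φ (q a) = g a := by
  refine ⟨(LinearMap.ker q).liftQ g h ∘ₗ (q.quotKerEquivOfSurjective hq).symm, fun a => ?_⟩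
  have : (q.quotKerEquivOfSurjective hq).symm (q a) = (LinearMap.ker q).mkQ a := by
    rw [LinearEquiv.symm_apply_eq]; rfl
  simp only [LinearMap.comp_apply, LinearEquiv.coe_coe, this]
  exact Submodule.liftQ_apply _ _ _

/-! ### Existence of flat precovers -/

section Precover

universe v

variable {R : Type v} [CommRing R]

open Cardinal

/-- Constructors of `ReducedTree`: the isomorphism type over `M` of a module with a generating
family indexed by `L`, a set of generators already interpreted, and one further generator. -/
abbrev ReducedIndex (R L M : Type v) [CommRing R] : Type v :=
  Submodule R (L →₀ R) × (L → M) × Set L × L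

/-- A type, depending only on `R`, `L` and `M`, that surjects onto all modules over `M` whose
kernel contains no nonzero pure submodule. -/
abbrev ReducedTree (R L M : Type v) [CommRing R] : Type v :=
  WType fun a : ReducedIndex R L M => a.2.2.1

variable {L F M : Type v} [AddCommGroup F] [Module R F] [AddCommGroup M] [Module R M]

/-- `e` realises the isomorphism type `(K, m)` in `F` and extends `d`. -/
def IsRealisation (f : F →ₗ[R] M) (K : Submodule R (L →₀ R)) (m : L → M) (S : Set L)
    (d : S → F) (e : L → F) : Prop :=
  (∀ s : S, e s = d s) ∧ K ≤ LinearMap.ker (Finsupp.linearCombination R e) ∧ ∀ l, f (e l) = m l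

open Classical in
/-- Interpretation of a tree in `F` by choosing realisations. -/
noncomputable def ReducedTree.eval (f : F →ₗ[R] M) : ReducedTree R L M → F :=
  WType.elim F fun p =>
    if h : ∃ e, IsRealisation f p.1.1 p.1.2.1 p.1.2.2.1 p.2 e then h.choose p.1.2.2.2 else 0

/-- The chosen realisation depends only on data from `R`, `L`, `M` and on values already reached. It
is a homomorphic image of `A` over `M` fixing what was already reached, and its generators are again
values of trees. -/
theorem ReducedTree.exists_reflection [Nonempty L] (f : F →ₗ[R] M)
    (A : Submodule R F) (hA : #A ≤ #L) :
    ∃ φ : A →ₗ[R] F, (∀ a : A, (a : F) ∈ Set.range (eval (L := L) f) → φ a = a) ∧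
      (∀ a, φ a ∈ Set.range (eval (L := L) f)) ∧ ∀ a : A, f (φ a) = f a := by
  obtain ⟨j⟩ := hA
  let e : L → A := Function.invFun j
  have he : Function.Surjective e := Function.invFun_surjective j.injective
  let S : Set L := {l | (e l : F) ∈ Set.range (eval (L := L) f)}
  choose d hd using fun l : S => l.2
  let K := LinearMap.ker (Finsupp.linearCombination R e)
  -- The inclusion of `A` is itself a realisation, so `eval` does not take its default value here.
  have hex : ∃ e', IsRealisation f K (fun l => f (e l)) S (fun l => eval f (d l)) e' := by
    refine ⟨fun l => e l, fun s => (hd s).symm, fun x hx => ?_, fun l => rfl⟩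
    have := congrArg A.subtype (LinearMap.mem_ker.1 hx)
    rw [Finsupp.linearCombination_apply, Finsupp.sum, map_sum] at this
    rw [LinearMap.mem_ker, Finsupp.linearCombination_apply, Finsupp.sum]
    simpa using this
  obtain ⟨h1, h2, h3⟩ := hex.choose_spec
  have h4 : ∀ l, hex.choose l ∈ Set.range (eval (L := L) f) := by
    intro l
    refine ⟨WType.mk (K, fun l => f (e l), S, l) d, ?_⟩
    exact dif_pos hex
  have hsurj : Function.Surjective (Finsupp.linearCombination R e) := fun a => by
    obtain ⟨l, rfl⟩ := he a
    exact ⟨Finsupp.single l 1, by simp⟩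
  obtain ⟨φ, hφ⟩ := exists_comp_eq_of_ker_le _ hsurj (Finsupp.linearCombination R hex.choose) h2
  have hφe : ∀ l, φ (e l) = hex.choose l := fun l => by
    simpa using hφ (Finsupp.single l 1)
  refine ⟨φ, fun a ha => ?_, fun a => ?_, fun a => ?_⟩ <;> obtain ⟨l, rfl⟩ := he a
  · rw [hφe, h1 ⟨l, ha⟩]
    exact hd ⟨l, ha⟩
  · rw [hφe]; exact h4 l
  · rw [hφe, h3]

/-- The set `Z` of values is a pure submodule, since reflections carry small configurations into `Z`
and fix what lies there. If x ∉ Z, take a small A ∋ x with A + Z pure and a reflection φ. The image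
of id − φ on `A` lies in the kernel of `f`, meets `Z` only in 0 and is pure; hence it is zero and x
= φ x lies in `Z`. -/
theorem ReducedTree.eval_surjective [Infinite L] (hL : #R ≤ #L) (f : F →ₗ[R] M)
    (hf : ∀ Q : Submodule R F, IsPureSub Q → Q ≤ LinearMap.ker f → Q = ⊥) :
    Function.Surjective (eval (L := L) f) := by
  have hinf : ℵ₀ ≤ #L := aleph0_le_mk L
  have href := exists_reflection (L := L) f
  have hsmall : ∀ X : Set F, X.Finite → ∃ A : Submodule R F, X ⊆ A ∧ #A ≤ #L := by
    intro X hX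
    obtain ⟨A, h1, h2, -⟩ := exists_small_sup_isPureSub (R := R) (isPureSub_bot (F := F)) hinf hL X
      ((lt_aleph0_iff_set_finite.2 hX).le.trans hinf)
    exact ⟨A, h1, h2⟩
  let Z : Submodule R F :=
    { carrier := Set.range (eval (L := L) f)
      zero_mem' := by
        obtain ⟨A, -, h⟩ := hsmall ∅ Set.finite_empty
        obtain ⟨φ, -, h2, -⟩ := href A h
        simpa using h2 0
      add_mem' := by
        intro a b ha hb
        obtain ⟨A, hX, h⟩ := hsmall {a, b} (by simp)
        obtain ⟨φ, h1, h2, -⟩ := href A h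
        have h3 := h2 (⟨a, hX (by simp)⟩ + ⟨b, hX (by simp)⟩)
        rwa [map_add, h1 _ ha, h1 _ hb] at h3
      smul_mem' := by
        intro r a ha
        obtain ⟨A, hX, h⟩ := hsmall {a} (by simp)
        obtain ⟨φ, h1, h2, -⟩ := href A h
        have h3 := h2 (r • ⟨a, hX (by simp)⟩)
        rwa [map_smul, h1 _ ha] at h3 }
  have hZ : IsPureSub Z := by
    intro n r x hx
    obtain ⟨A, hX, h⟩ := hsmall (Set.range x) (Set.finite_range x)
    obtain ⟨φ, h1, h2, -⟩ := href A h
    refine ⟨fun i => φ ⟨x i, hX ⟨i, rfl⟩⟩, fun i => h2 _, ?_⟩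
    have hs : ((∑ i, r i • ⟨x i, hX ⟨i, rfl⟩⟩ : A) : F) = ∑ i, r i • x i := by simp
    have h3 := h1 (∑ i, r i • ⟨x i, hX ⟨i, rfl⟩⟩) (by rw [hs]; exact hx)
    rw [hs, map_sum] at h3
    simpa only [map_smul] using h3
  intro x
  by_contra hx
  obtain ⟨A, hX, h, hAZ⟩ := exists_small_sup_isPureSub hZ hinf hL {x}
    (by simpa using one_le_aleph0.trans hinf)
  obtain ⟨φ, h1, h2, h3⟩ := href A h
  let δ : A →ₗ[R] F := A.subtype - φ
  have hint : ∀ p ∈ LinearMap.range δ, p ∈ Z → p = 0 := by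
    rintro _ ⟨a, rfl⟩ hp
    have ha : (a : F) ∈ Z := by
      have := Z.add_mem hp (h2 a)
      simpa [δ] using this
    simp [δ, h1 a ha]
  -- Solve in A + Z and apply `δ` to the components in `A`. The remaining error lies both in the
  -- range of `δ` and in `Z`, so it vanishes.
  have hpure : IsPureSub (LinearMap.range δ) := by
    intro n r y hy
    obtain ⟨a, ha⟩ := hy
    have hy' : ∑ i, r i • y i ∈ A ⊔ Z := by
      rw [← ha]
      exact sub_mem (Submodule.mem_sup_left a.2) (Submodule.mem_sup_right (h2 a))
    obtain ⟨y', hy', he⟩ := hAZ _ _ _ hy'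
    choose b hb z hz hbz using fun i => Submodule.mem_sup.1 (hy' i)
    refine ⟨fun i => δ ⟨b i, hb i⟩, fun i => ⟨_, rfl⟩, ?_⟩
    have key : ∑ i, r i • y i - ∑ i, r i • δ ⟨b i, hb i⟩ =
        ∑ i, r i • (φ ⟨b i, hb i⟩ + z i) := by
      rw [← he, ← Finset.sum_sub_distrib]
      refine Finset.sum_congr rfl fun i _ => ?_
      rw [← hbz, ← smul_sub]
      congr 1
      simp only [δ, LinearMap.sub_apply, Submodule.subtype_apply]
      abel
    have h0 : ∑ i, r i • y i - ∑ i, r i • δ ⟨b i, hb i⟩ = 0 := by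
      apply hint
      · exact sub_mem ⟨a, ha⟩ (Submodule.sum_mem _ fun i _ => Submodule.smul_mem _ _ ⟨_, rfl⟩)
      · rw [key]
        exact Submodule.sum_mem _ fun i _ =>
          Submodule.smul_mem _ _ (Z.add_mem (h2 _) (hz i))
    exact (sub_eq_zero.1 h0).symm
  have hbot := hf _ hpure (by rintro _ ⟨a, rfl⟩; simp [δ, h3])
  have hxA : x ∈ A := hX rfl
  have hδ : δ ⟨x, hxA⟩ = 0 := by
    rw [← Submodule.mem_bot (R := R), ← hbot]; exact ⟨_, rfl⟩
  have : x = φ ⟨x, hxA⟩ := by simpa [δ, sub_eq_zero] using hδ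
  exact hx (this ▸ h2 _)

/-- A flat quotient of the free module on `W` together with a map to `M`. -/
structure FlatQuotientOver (R W M : Type v) [CommRing R] [AddCommGroup M] [Module R M] where
  ker : Submodule R (W →₀ R)
  flat : Flat R ((W →₀ R) ⧸ ker)
  map : ((W →₀ R) ⧸ ker) →ₗ[R] M

/-- The underlying module of a `FlatQuotientOver`. -/
def FlatQuotientOver.Carrier {R W M : Type v} [CommRing R] [AddCommGroup M] [Module R M]
    (i : FlatQuotientOver R W M) : Type v :=
  (W →₀ R) ⧸ i.ker

noncomputable instance {R W M : Type v} [CommRing R] [AddCommGroup M] [Module R M]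
    (i : FlatQuotientOver R W M) : AddCommGroup i.Carrier :=
  inferInstanceAs (AddCommGroup ((W →₀ R) ⧸ i.ker))

noncomputable instance {R W M : Type v} [CommRing R] [AddCommGroup M] [Module R M]
    (i : FlatQuotientOver R W M) : Module R i.Carrier :=
  inferInstanceAs (Module R ((W →₀ R) ⧸ i.ker))

/-- Every module has a flat precover. -/
theorem exists_isFlatPrecover (M : Type v) [AddCommGroup M] [Module R M] :
    ∃ (F : Type v) (_ : AddCommGroup F) (_ : Module R F) (f : F →ₗ[R] M), IsFlatPrecover f := by
  classical
  -- `L` has to be infinite and at least as large as `R`.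
  let L : Type v := R ⊕ ULift.{v} ℕ
  have hL : #R ≤ #L := mk_le_of_injective (f := Sum.inl) Sum.inl_injective
  let W := ReducedTree R L M
  let ι := FlatQuotientOver R W M
  have : ∀ i : ι, Flat R (i.Carrier) := fun i => i.flat
  -- All flat quotients of the free module on `W`, with all their maps to `M`, form a type in the
  -- same universe; their direct sum is the precover.
  refine ⟨Π₀ i : ι, i.Carrier, inferInstance, inferInstance,
    DFinsupp.lsum ℕ fun i : ι => (i.map : i.Carrier →ₗ[R] M), inferInstance, ?_⟩
  intro F' _ _ _ g
  obtain ⟨P, hPg, hP, hred⟩ := exists_reduced_quotient g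
  have hflat := flat_quotient_of_isPureSub hP
  have hs := ReducedTree.eval_surjective (L := L) hL (P.liftQ g hPg) hred
  let q : (W →₀ R) →ₗ[R] (F' ⧸ P) :=
    Finsupp.linearCombination R (ReducedTree.eval (L := L) (P.liftQ g hPg))
  have hq : Function.Surjective q := fun a => by
    obtain ⟨w, rfl⟩ := hs a
    exact ⟨Finsupp.single w 1, by simp [q]⟩
  let E := q.quotKerEquivOfSurjective hq
  let i : ι := ⟨LinearMap.ker q, Flat.of_linearEquiv E, P.liftQ g hPg ∘ₗ E.toLinearMap⟩
  refine ⟨DFinsupp.lsingle (R := R) (M := fun i : ι => i.Carrier) i ∘ₗ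
    (E.symm.toLinearMap : F' ⧸ P →ₗ[R] i.Carrier) ∘ₗ P.mkQ, ?_⟩
  ext x
  have h : P.liftQ g hPg (E (E.symm (P.mkQ x))) = g x := by
    rw [LinearEquiv.apply_symm_apply]; rfl
  exact (DFinsupp.lsum_single ℕ (fun i : ι => (i.map : i.Carrier →ₗ[R] M)) i _).trans h

end Precover

/-! ### Transfinite chains of copies of a module over M -/

section Chain

variable {R F M J : Type*} [CommRing R] [AddCommGroup F] [Module R F] [AddCommGroup M] [Module R M]

theorem flat_finsupp (J : Type*) [Flat R F] : Flat R (J →₀ F) := by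
  classical
  exact Flat.of_linearEquiv (finsuppLequivDFinsupp R (ι := J) (M := F))

theorem eqOn_supported {N : Type*} [AddCommGroup N] [Module R N] {S : Set J}
    {u v : (J →₀ F) →ₗ[R] N}
    (h : ∀ δ ∈ S, ∀ x, u (Finsupp.single δ x) = v (Finsupp.single δ x))
    {t : J →₀ F} (ht : t ∈ Finsupp.supported F R S) : u t = v t := by
  rw [← Finsupp.sum_single t, map_finsuppSum, map_finsuppSum]
  exact Finsupp.sum_congr fun δ hδ => h δ (ht hδ) _

variable [LinearOrder J]

/-- Given `g : F^(J) → F`, the map `F^(J) → F` that is `g` below `γ`, the identity at `γ`, and zero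
above `γ`. -/
noncomputable def stageMap (γ : J) (g : (J →₀ F) →ₗ[R] F) : (J →₀ F) →ₗ[R] F :=
  Finsupp.lsum ℕ fun δ =>
    if δ < γ then g ∘ₗ Finsupp.lsingle δ else if δ = γ then LinearMap.id else 0

/-- The kernel of `stageMap γ g` on the part of `F^(J)` supported up to `γ`. -/
noncomputable def stageKer (γ : J) (g : (J →₀ F) →ₗ[R] F) : Submodule R (J →₀ F) :=
  Finsupp.supported F R (Set.Iic γ) ⊓ LinearMap.ker (stageMap γ g)

/-- A projection of `F^(J)` onto `stageKer γ g`. -/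
noncomputable def stageProj (γ : J) (g : (J →₀ F) →ₗ[R] F) : (J →₀ F) →ₗ[R] (J →₀ F) :=
  (Finsupp.supported F R (Set.Iic γ)).subtype ∘ₗ Finsupp.restrictDom F R (Set.Iic γ) -
    Finsupp.lsingle γ ∘ₗ stageMap γ g

theorem stageMap_single_lt {γ δ : J} (h : δ < γ) (g : (J →₀ F) →ₗ[R] F) (x : F) :
    stageMap γ g (Finsupp.single δ x) = g (Finsupp.single δ x) := by
  simp [stageMap, h]

theorem stageMap_single_self (γ : J) (g : (J →₀ F) →ₗ[R] F) (x : F) :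
    stageMap γ g (Finsupp.single γ x) = x := by
  simp [stageMap]

theorem stageMap_single_gt {γ δ : J} (h : γ < δ) (g : (J →₀ F) →ₗ[R] F) (x : F) :
    stageMap γ g (Finsupp.single δ x) = 0 := by
  simp [stageMap, h.not_gt, h.ne']

theorem stageMap_of_mem_Iio {γ : J} (g : (J →₀ F) →ₗ[R] F) {t : J →₀ F}
    (ht : t ∈ Finsupp.supported F R (Set.Iio γ)) : stageMap γ g t = g t :=
  eqOn_supported (fun _ hδ x => stageMap_single_lt hδ g x) ht

theorem stageProj_mem (γ : J) (g : (J →₀ F) →ₗ[R] F) (t : J →₀ F) :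
    stageProj γ g t ∈ stageKer γ g := by
  have h1 : Finsupp.single γ (stageMap γ g t) ∈ Finsupp.supported F R (Set.Iic γ) :=
    Finsupp.single_mem_supported _ _ (Set.mem_Iic.2 le_rfl)
  refine ⟨sub_mem (Submodule.coe_mem _) h1, ?_⟩
  have : stageMap γ g ∘ₗ (Finsupp.supported F R (Set.Iic γ)).subtype ∘ₗ
      Finsupp.restrictDom F R (Set.Iic γ) = stageMap γ g := by
    refine Finsupp.lhom_ext fun δ x => ?_
    simp only [LinearMap.comp_apply, Submodule.subtype_apply, Finsupp.restrictDom_apply]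
    by_cases h : δ ≤ γ
    · rw [Finsupp.filter_single_of_pos _ (by simpa using h)]
    · rw [Finsupp.filter_single_of_neg _ (by simpa using h), map_zero,
        stageMap_single_gt (not_le.1 h)]
  have h2 := LinearMap.congr_fun this t
  simp only [LinearMap.comp_apply] at h2
  simp only [stageProj, SetLike.mem_coe, LinearMap.mem_ker, LinearMap.sub_apply, map_sub,
    LinearMap.comp_apply, h2, Finsupp.lsingle_apply, stageMap_single_self, sub_self]

/-- Modulo `stageKer γ g`, everything supported up to `γ` is concentrated at `γ`. Each stage of the
quotient is thus a copy of `F`, and the whole quotient is the limit of a chain of such copies. -/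
theorem sub_single_stageMap_mem {γ : J} (g : (J →₀ F) →ₗ[R] F) {t : J →₀ F}
    (ht : t ∈ Finsupp.supported F R (Set.Iic γ)) :
    t - Finsupp.single γ (stageMap γ g t) ∈ stageKer γ g := by
  have := stageProj_mem γ g t
  simp only [stageProj, LinearMap.sub_apply, LinearMap.comp_apply, Submodule.subtype_apply,
    Finsupp.restrictDom_apply, Finsupp.lsingle_apply] at this
  rwa [(Finsupp.filter_eq_self_iff _ _).2] at this
  intro δ hδ
  exact ht (Finsupp.mem_support_iff.2 hδ)

theorem stageProj_of_mem {γ : J} {g : (J →₀ F) →ₗ[R] F} {t : J →₀ F} (ht : t ∈ stageKer γ g) :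
    stageProj γ g t = t := by
  have h2 : stageMap γ g t = 0 := ht.2
  simp only [stageProj, LinearMap.sub_apply, LinearMap.comp_apply, Submodule.subtype_apply,
    Finsupp.restrictDom_apply, Finsupp.lsingle_apply, h2, Finsupp.single_zero, sub_zero]
  rw [Finsupp.filter_eq_self_iff]
  intro δ hδ
  exact ht.1 (Finsupp.mem_support_iff.2 hδ)

/-- `stageProj` is a linear retraction, and direct summands are pure. -/
theorem isPureSub_stageKer (γ : J) (g : (J →₀ F) →ₗ[R] F) : IsPureSub (stageKer γ g) := by
  intro n r x hx
  refine ⟨fun i => stageProj γ g (x i), fun i => stageProj_mem _ _ _, ?_⟩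
  have := stageProj_of_mem hx
  simpa using this

/-- The submodule of `F^(J)` identified with zero by the stages in `S`. -/
noncomputable def chainKer (g : J → (J →₀ F) →ₗ[R] F) (S : Set J) : Submodule R (J →₀ F) :=
  ⨆ γ : S, stageKer γ.1 (g γ)

/-- The maps `g` form a coherent chain of maps over `M`. -/
structure IsChainOver (f : F →ₗ[R] M) (g : J → (J →₀ F) →ₗ[R] F) (S : Set J) : Prop where
  comp_eq : ∀ β ∈ S, f ∘ₗ g β = Finsupp.lsum ℕ fun _ => f
  le_ker : ∀ β ∈ S, chainKer g (Set.Iio β) ≤ LinearMap.ker (g β)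

theorem stageKer_le_chainKer (g : J → (J →₀ F) →ₗ[R] F) {S : Set J} {γ : J} (h : γ ∈ S) :
    stageKer γ (g γ) ≤ chainKer g S :=
  le_iSup (fun γ : S => stageKer γ.1 (g γ)) ⟨γ, h⟩

variable {f : F →ₗ[R] M} {g : J → (J →₀ F) →ₗ[R] F} {S : Set J}

/-- For γ < δ, an element of the earlier kernel is supported below `δ`, where `stageMap` is `g δ`;
coherence says that `g δ` kills it. -/
theorem IsChainOver.stageKer_mono (hg : IsChainOver f g S) {γ δ : J} (hδ : δ ∈ S) (h : γ ≤ δ) :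
    stageKer γ (g γ) ≤ stageKer δ (g δ) := by
  obtain rfl | h := h.eq_or_lt
  · exact le_rfl
  intro t ht
  refine ⟨Finsupp.supported_mono (Set.Iic_subset_Iic.2 h.le) ht.1, ?_⟩
  have h1 : t ∈ Finsupp.supported F R (Set.Iio δ) :=
    Finsupp.supported_mono (Set.Iic_subset_Iio.2 h) ht.1
  rw [SetLike.mem_coe, LinearMap.mem_ker, stageMap_of_mem_Iio _ h1]
  exact hg.le_ker δ hδ (stageKer_le_chainKer g (S := Set.Iio δ) h ht)

theorem IsChainOver.directed (hg : IsChainOver f g S) :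
    Directed (· ≤ ·) fun γ : S => stageKer γ.1 (g γ) := by
  intro a b
  obtain h | h := le_total a.1 b.1
  · exact ⟨b, hg.stageKer_mono b.2 h, le_rfl⟩
  · exact ⟨a, le_rfl, hg.stageKer_mono a.2 h⟩

theorem IsChainOver.isPureSub (hg : IsChainOver f g S) : IsPureSub (chainKer g S) := by
  rcases isEmpty_or_nonempty S with h | h
  · rw [chainKer, iSup_of_empty]; exact isPureSub_bot
  · rw [chainKer, iSup]
    refine isPureSub_sSup (Set.range_nonempty _) hg.directed.directedOn_range ?_
    rintro _ ⟨γ, rfl⟩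
    exact isPureSub_stageKer _ _

theorem IsChainOver.mem_iff (hg : IsChainOver f g S) [Nonempty S] {t : J →₀ F} :
    t ∈ chainKer g S ↔ ∃ γ ∈ S, t ∈ stageKer γ (g γ) := by
  rw [chainKer, Submodule.mem_iSup_of_directed _ hg.directed]
  simp

/-- This gives the limit its map to `M`: up to `γ`, the sum of the copies of `f` equals `f` after
`stageMap`, which vanishes on the kernel. -/
theorem IsChainOver.le_ker_lsum (hg : IsChainOver f g S) :
    chainKer g S ≤ LinearMap.ker (Finsupp.lsum ℕ fun _ : J => f) := by
  refine iSup_le fun γ t ht => ?_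
  have h1 : f (stageMap γ.1 (g γ) t) = Finsupp.lsum ℕ (fun _ : J => f) t := by
    refine eqOn_supported (u := f ∘ₗ stageMap γ.1 (g γ)) (fun δ hδ x => ?_) ht.1
    rw [LinearMap.comp_apply]
    obtain rfl | h := (Set.mem_Iic.1 hδ).eq_or_lt
    · simp [stageMap_single_self]
    · rw [stageMap_single_lt h, ← hg.comp_eq γ γ.2, LinearMap.comp_apply]
  have h2 : stageMap γ.1 (g γ) t = 0 := ht.2
  rw [LinearMap.mem_ker, ← h1, h2, map_zero]

theorem IsChainOver.mono (hg : IsChainOver f g S) {S' : Set J} (h : S' ⊆ S) :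
    IsChainOver f g S' :=
  ⟨fun β hβ => hg.comp_eq β (h hβ), fun β hβ => hg.le_ker β (h hβ)⟩

/-- Transfinite construction of a chain by successive choices. -/
theorem exists_isChainOver [WellFoundedLT J] (f : F →ₗ[R] M)
    (Φ : J → Submodule R (J →₀ F) → ((J →₀ F) →ₗ[R] F) → Prop)
    (hΦ : ∀ β P, IsPureSub P → P ≤ LinearMap.ker (Finsupp.lsum ℕ fun _ : J => f) →
      ∃ g : (J →₀ F) →ₗ[R] F, f ∘ₗ g = (Finsupp.lsum ℕ fun _ => f) ∧ P ≤ LinearMap.ker g ∧ Φ β P g) :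
    ∃ g : J → (J →₀ F) →ₗ[R] F, IsChainOver f g Set.univ ∧
      ∀ β, Φ β (chainKer g (Set.Iio β)) (g β) := by
  classical
  -- The recursion needs a total choice, so 0 is the default; the induction below shows that it is
  -- never used.
  let c : J → Submodule R (J →₀ F) → ((J →₀ F) →ₗ[R] F) := fun β P =>
    if h : ∃ g : (J →₀ F) →ₗ[R] F,
      f ∘ₗ g = (Finsupp.lsum ℕ fun _ => f) ∧ P ≤ LinearMap.ker g ∧ Φ β P g then h.choose else 0
  let step : ∀ β : J, (∀ γ, γ < β → (J →₀ F) →ₗ[R] F) → (J →₀ F) →ₗ[R] F := fun β g =>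
    c β (⨆ γ : Set.Iio β, stageKer γ.1 (g γ.1 γ.2))
  let g : J → (J →₀ F) →ₗ[R] F := (wellFounded_lt (α := J)).fix step
  have hg : ∀ β, g β = c β (chainKer g (Set.Iio β)) := fun β => WellFounded.fix_eq _ step β
  have key : ∀ β, f ∘ₗ g β = (Finsupp.lsum ℕ fun _ => f) ∧
      chainKer g (Set.Iio β) ≤ LinearMap.ker (g β) ∧ Φ β (chainKer g (Set.Iio β)) (g β) := by
    intro β
    induction β using WellFoundedLT.induction with
    | ind β ih =>
      have hc : IsChainOver f g (Set.Iio β) :=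
        ⟨fun γ hγ => (ih γ hγ).1, fun γ hγ => (ih γ hγ).2.1⟩
      have hex := hΦ β _ hc.isPureSub hc.le_ker_lsum
      have : g β = hex.choose := by rw [hg]; exact dif_pos hex
      rw [this]
      exact hex.choose_spec
  exact ⟨g, ⟨fun β _ => (key β).1, fun β _ => (key β).2.1⟩, fun β => (key β).2.2⟩

end Chain

/-! ### From flat precovers to flat covers -/

section Cover

universe v

open Cardinal

variable {R F M : Type v} [CommRing R] [AddCommGroup F] [Module R F] [AddCommGroup M] [Module R M]

/-- Take the initial ordinal of the successor cardinal of max(|F|, ℵ₀). This cardinal is regular, so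
families indexed by `F` or ℕ are bounded, and it exceeds |F|. -/
theorem exists_wellOrder_bounded (F : Type v) : ∃ (J : Type v) (_ : LinearOrder J)
    (_ : WellFoundedLT J), Nonempty J ∧ (∀ k : F → J, ∃ b, ∀ x, k x < b) ∧
      (∀ k : ℕ → J, ∃ b, ∀ x, k x < b) ∧ ∀ k : J → F, ¬ Function.Injective k := by
  let κ : Cardinal.{v} := max #F ℵ₀
  have hκ : ℵ₀ ≤ κ := le_max_right _ _
  have hreg := isRegular_succ hκ
  let J := (Order.succ κ).ord.ToType
  have hcof : Order.cof J = Order.succ κ := by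
    rw [Ordinal.cof_toType]; exact hreg.cof_ord
  have key : ∀ s : Set J, #s ≤ κ → ∃ b, ∀ x ∈ s, x < b := by
    intro s hs
    by_contra! h
    have : IsCofinal s := fun b => by
      obtain ⟨x, hx, hb⟩ := h b
      exact ⟨x, hx, hb⟩
    have h2 := (Order.cof_le this).trans hs
    rw [hcof] at h2
    exact (Order.lt_succ κ).not_ge h2
  refine ⟨J, inferInstance, inferInstance, ?_, fun k => ?_, fun k => ?_, fun k hk => ?_⟩
  · obtain ⟨b, -⟩ := key ∅ (by simp)
    exact ⟨b⟩
  · obtain ⟨b, hb⟩ := key (Set.range k) (mk_range_le.trans (le_max_left _ _))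
    exact ⟨b, fun x => hb _ ⟨x, rfl⟩⟩
  · obtain ⟨b, hb⟩ := key (Set.range k)
      ((le_aleph0_iff_set_countable.2 (Set.countable_range k)).trans hκ)
    exact ⟨b, fun x => hb _ ⟨x, rfl⟩⟩
  · have h1 := mk_le_of_injective hk
    have h2 : #J = Order.succ κ := by simp [J]
    rw [h2] at h1
    exact (Order.lt_succ κ).not_ge (h1.trans (le_max_left _ _))

theorem exists_Iic_of_supported {J : Type*} [LinearOrder J] [Nonempty J] (t : J →₀ F) :
    ∃ γ, t ∈ Finsupp.supported F R (Set.Iic γ) := by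
  obtain ⟨γ, hγ⟩ := t.support.exists_le
  exact ⟨γ, fun δ hδ => hγ δ hδ⟩

/-- From a flat precover one obtains a flat precover whose endomorphisms over `M` are all
injective. -/
theorem IsFlatPrecover.exists_injective {f : F →ₗ[R] M} (hf : IsFlatPrecover f) :
    ∃ (F' : Type v) (_ : AddCommGroup F') (_ : Module R F') (f' : F' →ₗ[R] M),
      IsFlatPrecover f' ∧ ∀ u : F' →ₗ[R] F', f' ∘ₗ u = f' → Function.Injective u := by
  classical
  obtain ⟨J, _, _, _, hJF, hJN, -⟩ := exists_wellOrder_bounded F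
  have := hf.flat
  have := flat_finsupp (R := R) (F := F) J
  let fT : (J →₀ F) →ₗ[R] M := Finsupp.lsum ℕ fun _ => f
  -- A bad map kills something below `β` not yet killed. The chain makes a bad choice whenever one
  -- exists, so that nothing new can be killed in the limit.
  let Bad : J → Submodule R (J →₀ F) → ((J →₀ F) →ₗ[R] F) → Prop := fun β P g =>
    ∃ p ∈ Finsupp.supported F R (Set.Iio β), p ∉ P ∧ g p = 0
  obtain ⟨g, hg, hbad⟩ := exists_isChainOver (J := J) f
    (fun β P g => (∃ g', f ∘ₗ g' = fT ∧ P ≤ LinearMap.ker g' ∧ Bad β P g') → Bad β P g) (by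
      intro β P hP hPf
      by_cases h : ∃ g', f ∘ₗ g' = fT ∧ P ≤ LinearMap.ker g' ∧ Bad β P g'
      · obtain ⟨g', h1, h2, h3⟩ := h
        exact ⟨g', h1, h2, fun _ => h3⟩
      · have := flat_quotient_of_isPureSub hP
        obtain ⟨w, hw⟩ := hf.exists_factorization _ (P.liftQ fT hPf)
        refine ⟨w ∘ₗ P.mkQ, ?_, ?_, fun h' => absurd h' h⟩
        · rw [← LinearMap.comp_assoc, hw, P.liftQ_mkQ]
        · rintro p hp
          have : P.mkQ p = 0 := by rwa [← LinearMap.mem_ker, P.ker_mkQ]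
          rw [LinearMap.mem_ker, LinearMap.comp_apply, this, map_zero])
  let P := chainKer g Set.univ
  have hPpure : IsPureSub P := hg.isPureSub
  have hPf : P ≤ LinearMap.ker fT := hg.le_ker_lsum
  have hflat := flat_quotient_of_isPureSub hPpure
  -- Up to arbitrarily late stages, everything that is ever killed has been killed.
  have hclose : ∀ γ₀, ∃ α, γ₀ < α ∧
      ∀ t ∈ Finsupp.supported F R (Set.Iio α), t ∈ P → t ∈ chainKer g (Set.Iio α) := by
    intro γ₀
    -- It is enough to treat elements concentrated at `β`; there are only |F| of these, so the
    -- stages killing them are bounded.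
    have hD : ∀ β, ∃ b, β < b ∧ ∀ x, Finsupp.single β x ∈ P →
        Finsupp.single β x ∈ chainKer g (Set.Iio b) := by
      intro β
      have h1 : ∀ x, ∃ k, Finsupp.single β x ∈ P → Finsupp.single β x ∈ stageKer k (g k) := by
        intro x
        by_cases h : Finsupp.single β x ∈ P
        · obtain ⟨k, -, hk⟩ := hg.mem_iff.1 h
          exact ⟨k, fun _ => hk⟩
        · exact ⟨β, fun h' => absurd h' h⟩
      choose k hk using h1
      obtain ⟨b, hb⟩ := hJF fun x => max β (k x)
      exact ⟨b, (le_max_left _ _).trans_lt (hb 0), fun x hx =>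
        stageKer_le_chainKer g (S := Set.Iio b) ((le_max_right _ _).trans_lt (hb x)) (hk x hx)⟩
    choose D hD1 hD2 using hD
    let b : ℕ → J := fun n => D^[n] γ₀
    have hb : ∀ n, b (n + 1) = D (b n) := fun n => Function.iterate_succ_apply' D n γ₀
    have hbm : Monotone b := monotone_nat_of_le_succ fun n => by rw [hb]; exact (hD1 _).le
    have hex : {c | ∀ n, b n < c}.Nonempty := hJN b
    -- `α` is the least strict upper bound of the iterates, so a finite support below `α` already
    -- lies below some `b n`.
    let α := (wellFounded_lt (α := J)).min _ hex
    have hα : ∀ n, b n < α := (wellFounded_lt (α := J)).min_mem _ hex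
    have hαmin : ∀ δ < α, ∃ n, δ ≤ b n := by
      intro δ hδ
      by_contra! h
      exact (wellFounded_lt (α := J)).not_lt_min {c | ∀ n, b n < c} (x := δ) h hδ
    refine ⟨α, hα 0, fun t ht htP => ?_⟩
    have h1 : ∃ n, t ∈ Finsupp.supported F R (Set.Iic (b n)) := by
      have h2 : ∀ δ : J, ∃ n, δ < α → δ ≤ b n := fun δ => by
        by_cases h : δ < α
        · obtain ⟨n, hn⟩ := hαmin δ h
          exact ⟨n, fun _ => hn⟩
        · exact ⟨0, fun h' => absurd h' h⟩
      choose k hk using h2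
      refine ⟨t.support.sup k, fun δ hδ => (hk δ (ht hδ)).trans (hbm ?_)⟩
      exact Finset.le_sup (f := k) hδ
    obtain ⟨n, hn⟩ := h1
    have h3 := sub_single_stageMap_mem (g (b n)) hn
    have h4 : Finsupp.single (b n) (stageMap (b n) (g (b n)) t) ∈ P := by
      have := P.sub_mem htP (stageKer_le_chainKer g (Set.mem_univ (b n)) h3)
      rwa [sub_sub_cancel] at this
    have h5 := hD2 _ _ h4
    rw [← hb] at h5
    have hle : chainKer g (Set.Iio (b (n + 1))) ≤ chainKer g (Set.Iio α) :=
      iSup_le fun γ => stageKer_le_chainKer g (lt_trans γ.2 (hα _))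
    have := add_mem (stageKer_le_chainKer g (S := Set.Iio α) (hα n) h3) (hle h5)
    rwa [sub_add_cancel] at this
  have hker : ∀ u : (J →₀ F) →ₗ[R] F, f ∘ₗ u = fT → P ≤ LinearMap.ker u →
      LinearMap.ker u ≤ P := by
    intro u hu hPu p hp
    by_contra hpP
    obtain ⟨γ, hγ⟩ := exists_Iic_of_supported (R := R) p
    obtain ⟨α, hγα, hα⟩ := hclose γ
    have hle : chainKer g (Set.Iio α) ≤ P :=
      iSup_le fun γ => stageKer_le_chainKer g (Set.mem_univ γ.1)
    -- Since `u` is a bad choice at `α`, so is `g α`; but what `g α` kills lies in `P`, hence was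
    -- killed before `α`.
    obtain ⟨q, hq, hqP, hgq⟩ := hbad α ⟨u, hu, hle.trans hPu, p,
      Finsupp.supported_mono (Set.Iic_subset_Iio.2 hγα) hγ, fun h => hpP (hle h), hp⟩
    refine hqP (hα q hq (stageKer_le_chainKer g (Set.mem_univ α) ⟨?_, ?_⟩))
    · exact Finsupp.supported_mono Set.Iio_subset_Iic_self hq
    · rw [SetLike.mem_coe, LinearMap.mem_ker, stageMap_of_mem_Iio _ hq, hgq]
  refine ⟨(J →₀ F) ⧸ P, inferInstance, inferInstance, P.liftQ fT hPf, ⟨hflat, ?_⟩, ?_⟩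
  · intro F' _ _ _ k
    obtain ⟨w, hw⟩ := hf.exists_factorization F' k
    refine ⟨P.mkQ ∘ₗ Finsupp.lsingle (Classical.arbitrary J) ∘ₗ w, ?_⟩
    rw [← LinearMap.comp_assoc, P.liftQ_mkQ, ← LinearMap.comp_assoc, ← hw]
    congr 1
    ext x
    simp [fT]
  · intro u hu
    obtain ⟨w, hw⟩ := hf.exists_factorization _ (P.liftQ fT hPf)
    -- Composing with a factorization `w` back to `F` reduces injectivity of `u` to `hker`.
    have h1 := hker (w ∘ₗ u ∘ₗ P.mkQ) (by
      rw [← LinearMap.comp_assoc, hw, ← LinearMap.comp_assoc, hu, P.liftQ_mkQ]) (by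
      rintro p hp
      have : P.mkQ p = 0 := by rwa [← LinearMap.mem_ker, P.ker_mkQ]
      rw [LinearMap.mem_ker, LinearMap.comp_apply, LinearMap.comp_apply, this, map_zero, map_zero])
    rw [injective_iff_map_eq_zero]
    intro a ha
    obtain ⟨p, rfl⟩ := P.mkQ_surjective a
    have : p ∈ P := h1 (by
      rw [LinearMap.mem_ker, LinearMap.comp_apply, LinearMap.comp_apply, ha, map_zero])
    rwa [← LinearMap.mem_ker, P.ker_mkQ]

/-- A flat precover whose endomorphisms over `M` are injective is a flat cover. -/
theorem IsFlatPrecover.isFlatCover_of_injective {f : F →ₗ[R] M} (hf : IsFlatPrecover f)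
    (hinj : ∀ u : F →ₗ[R] F, f ∘ₗ u = f → Function.Injective u) : IsFlatCover f := by
  refine ⟨hf, fun h hh => ⟨hinj h hh, ?_⟩⟩
  by_contra hsurj
  have := hf.flat
  obtain ⟨J, _, _, _, -, -, hJ⟩ := exists_wellOrder_bounded F
  have := flat_finsupp (R := R) (F := F) J
  let fT : (J →₀ F) →ₗ[R] M := Finsupp.lsum ℕ fun _ => f
  have hext : ∀ P : Submodule R (J →₀ F), IsPureSub P → P ≤ LinearMap.ker fT →
      ∃ w : (J →₀ F) →ₗ[R] F, f ∘ₗ w = fT ∧ P ≤ LinearMap.ker w := by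
    intro P hP hPf
    have := flat_quotient_of_isPureSub hP
    obtain ⟨w, hw⟩ := hf.exists_factorization _ (P.liftQ fT hPf)
    refine ⟨w ∘ₗ P.mkQ, ?_, ?_⟩
    · rw [← LinearMap.comp_assoc, hw, P.liftQ_mkQ]
    · rintro p hp
      have : P.mkQ p = 0 := by rwa [← LinearMap.mem_ker, P.ker_mkQ]
      rw [LinearMap.mem_ker, LinearMap.comp_apply, this, map_zero]
  -- Composing every connecting map with `h` keeps it over `M` and forces its values into the range
  -- of `h`.
  obtain ⟨g, hg, hrange⟩ := exists_isChainOver (J := J) f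
    (fun _ _ g => ∀ t, g t ∈ LinearMap.range h) (by
      intro β P hP hPf
      obtain ⟨w, hw, hPw⟩ := hext P hP hPf
      refine ⟨h ∘ₗ w, ?_, ?_, fun t => ⟨w t, rfl⟩⟩
      · rw [← LinearMap.comp_assoc, hh, hw]
      · intro p hp
        rw [LinearMap.mem_ker, LinearMap.comp_apply, LinearMap.mem_ker.1 (hPw hp), map_zero])
  obtain ⟨u, hu, hPu⟩ := hext _ hg.isPureSub hg.le_ker_lsum
  obtain ⟨y, hy⟩ := not_forall.1 hsurj
  have huinj : ∀ γ, Function.Injective fun x => u (Finsupp.single γ x) := by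
    intro γ
    refine hinj (u ∘ₗ Finsupp.lsingle γ) ?_
    rw [← LinearMap.comp_assoc, hu]
    ext x
    simp [fT]
  -- In the limit, `y` at `β` equals `g γ` of it at `γ`. A coincidence with `y` at `γ` would, by
  -- injectivity of `u` on the copy at `γ`, put `y` in the range of `h`. So `J` would inject into
  -- `F`.
  have hne : ∀ β γ, β < γ → u (Finsupp.single β y) ≠ u (Finsupp.single γ y) := by
    intro β γ hβγ heq
    have hmem : Finsupp.single β y ∈ Finsupp.supported F R (Set.Iio γ) :=
      Finsupp.single_mem_supported _ _ hβγ
    have h1 := sub_single_stageMap_mem (g γ)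
      (Finsupp.supported_mono Set.Iio_subset_Iic_self hmem)
    have h2 : u _ = 0 := hPu (stageKer_le_chainKer g (Set.mem_univ γ) h1)
    rw [map_sub, sub_eq_zero, heq, stageMap_of_mem_Iio _ hmem] at h2
    have h3 := huinj γ h2
    exact hy (h3 ▸ hrange γ _)
  refine hJ (fun β => u (Finsupp.single β y)) fun β γ heq => ?_
  by_contra hβγ
  obtain hlt | hlt := lt_or_gt_of_ne hβγ
  · exact hne _ _ hlt heq
  · exact hne _ _ hlt heq.symm

/-- Every module has a flat cover. -/
theorem exists_isFlatCover (M : Type v) [AddCommGroup M] [Module R M] :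
    ∃ (F : Type v) (_ : AddCommGroup F) (_ : Module R F) (f : F →ₗ[R] M), IsFlatCover f := by
  obtain ⟨F, _, _, f, hf⟩ := exists_isFlatPrecover (R := R) M
  obtain ⟨F', _, _, f', hf', hinj⟩ := hf.exists_injective
  exact ⟨F', _, _, f', hf'.isFlatCover_of_injective hinj⟩

end Cover

/-! ### Ordinal filtrations with ideals as factors -/

section Filtration

universe v

theorem exists_quotient_equiv_ideal {S N : Type*} [CommRing S] [AddCommGroup N] [Module S N]
    {P B : Submodule S N} (v : P →ₗ[S] S) (hv : ∀ x : P, v x = 0 ↔ (x : N) ∈ B) :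
    ∃ I : Ideal S, Nonempty ((P ⧸ B.submoduleOf P) ≃ₗ[S] I) := by
  have h : B.submoduleOf P = LinearMap.ker v := by
    ext x
    rw [LinearMap.mem_ker, hv]
    rfl
  exact ⟨LinearMap.range v, ⟨(Submodule.quotEquivOfEq _ _ h).trans v.quotKerEquivRange⟩⟩

/-- A module with an exhaustive monotone family of submodules indexed by a well-order, whose
consecutive factors embed in the ring, is filtered by ideals. -/
theorem isFilteredByIdeals_of_wellOrder {S N : Type v} [CommRing S] [AddCommGroup N] [Module S N]
    {Y : Type v} [LinearOrder Y] [WellFoundedLT Y] (A : Y → Submodule S N) (hA : Monotone A)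
    (hex : ∀ x, ∃ y, x ∈ A y)
    (hlead : ∀ y, ∃ v : A y →ₗ[S] S, ∀ x : A y, v x = 0 ↔ (x : N) = 0 ∨ ∃ z < y, (x : N) ∈ A z) :
    IsFilteredByIdeals S N := by
  let rk : Y → Ordinal.{v} := Ordinal.typein (α := Y) (· < ·)
  have hrk : ∀ {y z}, rk y < rk z ↔ y < z := fun {y z} => Ordinal.typein_lt_typein (· < ·)
  let N' : Ordinal.{v} → Submodule S N := fun α => ⨆ y : {y // rk y < α}, A y
  have hmem : ∀ α x, x ∈ N' α ↔ x = 0 ∨ ∃ y, rk y < α ∧ x ∈ A y := by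
    intro α x
    rcases isEmpty_or_nonempty {y // rk y < α} with h | h
    · simp only [N', iSup_of_empty, Submodule.mem_bot]
      refine ⟨Or.inl, fun h' => h'.resolve_right ?_⟩
      rintro ⟨y, hy, -⟩
      exact h.elim ⟨y, hy⟩
    · have hd : Directed (· ≤ ·) fun y : {y // rk y < α} => A y :=
        (hA.comp (Subtype.mono_coe _)).directed_le
      simp only [N']
      rw [Submodule.mem_iSup_of_directed _ hd]
      constructor
      · rintro ⟨y, hy⟩
        exact Or.inr ⟨y, y.2, hy⟩
      · rintro (rfl | ⟨y, hy, hx⟩)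
        · exact ⟨Classical.arbitrary _, zero_mem _⟩
        · exact ⟨⟨y, hy⟩, hx⟩
  -- The successor of the order type includes the stage containing every `A y`, and `succ α` lies
  -- below it exactly when `α` is the rank of some `y`.
  refine ⟨Order.succ (Ordinal.type (α := Y) (· < ·)), N', ⟨?_, ?_, ?_, ?_⟩, ?_⟩
  · rw [eq_bot_iff]
    intro x hx
    obtain rfl | ⟨y, hy, -⟩ := (hmem _ _).1 hx
    · exact zero_mem _
    · exact absurd hy not_lt_zero
  · intro α β hαβ _ x hx
    rw [hmem] at hx ⊢
    exact hx.imp_right fun ⟨y, hy, h⟩ => ⟨y, hy.trans_le hαβ, h⟩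
  · intro β _ hβ
    ext x
    simp only [SetLike.mem_coe, Set.mem_iUnion, Set.mem_Iio, hmem, exists_prop]
    constructor
    · rintro (rfl | ⟨y, hy, hx⟩)
      · exact ⟨0, hβ.bot_lt, Or.inl rfl⟩
      · exact ⟨Order.succ (rk y), hβ.succ_lt hy, Or.inr ⟨y, Order.lt_succ _, hx⟩⟩
    · rintro ⟨α, hα, h⟩
      exact h.imp_right fun ⟨y, hy, h⟩ => ⟨y, hy.trans hα, h⟩
  · rw [Set.eq_univ_iff_forall]
    intro x
    obtain ⟨y, hy⟩ := hex x
    simp only [SetLike.mem_coe, Set.mem_iUnion, Set.mem_Iio, hmem, exists_prop]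
    exact ⟨_, Order.lt_succ _, Or.inr ⟨y, Ordinal.typein_lt_type _ y, hy⟩⟩
  · intro α hα
    have hα' : α < Ordinal.type (α := Y) (· < ·) := Order.succ_lt_succ_iff.1 hα
    obtain ⟨y, rfl⟩ := Ordinal.mem_range_typein_iff (· < ·) |>.2 hα'
    have h1 : N' (Order.succ (rk y)) = A y := by
      ext x
      rw [hmem]
      constructor
      · rintro (rfl | ⟨z, hz, hx⟩)
        · exact zero_mem _
        · refine hA ?_ hx
          rw [Order.lt_succ_iff, ← not_lt, hrk, not_lt] at hz
          exact hz
      · exact fun hx => Or.inr ⟨y, Order.lt_succ _, hx⟩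
    obtain ⟨v, hv⟩ := hlead y
    refine exists_quotient_equiv_ideal (v ∘ₗ (LinearEquiv.ofEq _ _ h1).toLinearMap) fun x => ?_
    have h2 := hv (LinearEquiv.ofEq _ _ h1 x)
    rw [LinearMap.comp_apply, LinearEquiv.coe_coe, h2, LinearEquiv.coe_ofEq_apply]
    refine Iff.trans ?_ (hmem (rk y) x).symm
    simp only [hrk]

/-- `Q` is the union of a well-ordered chain of submodules whose consecutive factors embed in
`R ⧸ (s)`. -/
structure CyclicFiltration {R : Type v} [CommRing R] (s : R) {Q : Type v} [AddCommGroup Q]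
    [Module R Q] {Y : Type v} [LinearOrder Y] (A : Y → Submodule R Q) : Prop where
  mono : Monotone A
  exists_mem : ∀ x, ∃ y, x ∈ A y
  lead : ∀ y, ∃ B : Submodule R Q, (∀ x, x ∈ B ↔ x = 0 ∨ ∃ z < y, x ∈ A z) ∧
    ∃ j : (R ⧸ Ideal.span {s}) →ₗ[R] (Q ⧸ B), Function.Injective j ∧
      ∀ x ∈ A y, B.mkQ x ∈ LinearMap.range j

/-- The filtration of `Q` is pulled back along `η`, so each factor embeds in R/(s). As R → R/(s) is
surjective, these embeddings are linear over R/(s), and their images are ideals. -/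
theorem CyclicFiltration.isFilteredByIdeals {R : Type v} [CommRing R] {s : R} {Q : Type v}
    [AddCommGroup Q] [Module R Q] {Y : Type v} [LinearOrder Y] [WellFoundedLT Y]
    {A : Y → Submodule R Q} (hA : CyclicFiltration s A) {N : Type v} [AddCommGroup N]
    [Module R N] [Module (R ⧸ Ideal.span {s}) N] [IsScalarTower R (R ⧸ Ideal.span {s}) N]
    (η : N →ₗ[R] Q) (hη : Function.Injective η) :
    IsFilteredByIdeals (R ⧸ Ideal.span {s}) N := by
  have hsurj : Function.Surjective (algebraMap R (R ⧸ Ideal.span {s})) := Ideal.Quotient.mk_surjective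
  let A' : Y → Submodule (R ⧸ Ideal.span {s}) N := fun y =>
    { carrier := η ⁻¹' A y
      add_mem' := fun {a b} ha hb => by
        simpa using (A y).add_mem ha hb
      zero_mem' := by simp
      smul_mem' := by
        intro r x hx
        obtain ⟨r, rfl⟩ := hsurj r
        rw [algebraMap_smul]
        simpa using (A y).smul_mem r hx }
  have hA' : ∀ y x, x ∈ A' y ↔ η x ∈ A y := fun _ _ => Iff.rfl
  refine isFilteredByIdeals_of_wellOrder A' (fun y z h x hx => hA.mono h hx)
    (fun x => hA.exists_mem (η x)) fun y => ?_
  obtain ⟨B, hB, j, hj, hAj⟩ := hA.lead y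
  let u : A' y →ₗ[R] LinearMap.range j := LinearMap.codRestrict (LinearMap.range j)
    (B.mkQ ∘ₗ η ∘ₗ (A' y).subtype.restrictScalars R) fun x => hAj _ x.2
  let v : A' y →ₗ[R] R ⧸ Ideal.span {s} := (LinearEquiv.ofInjective j hj).symm.toLinearMap ∘ₗ u
  refine ⟨LinearMap.extendScalarsOfSurjective hsurj v, fun x => ?_⟩
  have h1 : v x = 0 ↔ η x ∈ B := by
    have : v x = 0 ↔ u x = 0 := by simp [v]
    rw [this, ← Submodule.coe_eq_zero]
    exact Submodule.Quotient.mk_eq_zero _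
  refine h1.trans ((hB _).trans ?_)
  simp only [hA', map_eq_zero_iff _ hη]

end Filtration

/-! ### Adjoining s-th roots -/

section Divisible

universe v

/-- Formal linear combinations of elements of `G` and iterated formal `s`-th roots. -/
inductive RootTerm (R G : Type v) : Type v
  | of (g : G) : RootTerm R G
  | root (t : RootTerm R G) : RootTerm R G
  | add (t t' : RootTerm R G) : RootTerm R G
  | smul (r : R) (t : RootTerm R G) : RootTerm R G

namespace RootTerm

variable {R G : Type v} [CommRing R] [AddCommGroup G] [Module R G]

/-- The height of a term. -/
def height : RootTerm R G → ℕ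
  | of _ => 0
  | root t => t.height + 1
  | add t t' => max t.height t'.height
  | smul _ t => t.height

/-- The linear combination of elements of `G` and roots denoted by a term. -/
noncomputable def val : RootTerm R G → G × (RootTerm R G →₀ R)
  | of g => (g, 0)
  | root t => (0, Finsupp.single t 1)
  | add t t' => t.val + t'.val
  | smul r t => r • t.val

/-- The source of divisibility: each element of G × R^(Y) is the value of a term, and that term
indexes an s-th root of it. -/
theorem val_surjective : Function.Surjective (val (R := R) (G := G)) := by
  rintro ⟨g, c⟩
  induction c using Finsupp.induction with
  | zero => exact ⟨of g, rfl⟩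
  | single_add y r c _ _ ih =>
    obtain ⟨t, ht⟩ := ih
    refine ⟨add t (smul r (root y)), ?_⟩
    simp [val, ht, add_comm]

/-- The value of a term involves only roots of terms of smaller height, which makes the system of
relations triangular. -/
theorem height_lt_of_mem_support {t y : RootTerm R G} (h : t.val.2 y ≠ 0) :
    y.height < t.height := by
  induction t with
  | of g => simp [val] at h
  | root t ih =>
    simp only [val] at h
    rw [Finsupp.single_apply_ne_zero] at h
    rw [h.1]
    exact Nat.lt_succ_self _
  | add t t' ih ih' =>
    simp only [val, height, lt_max_iff] at h ⊢
    by_contra! hc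
    have h1 := mt ih hc.1.not_gt
    have h2 := mt ih' hc.2.not_gt
    rw [not_not] at h1 h2
    simp [h1, h2] at h
  | smul r t ih =>
    simp only [val, height] at h ⊢
    refine ih fun h1 => h ?_
    simp [h1]

end RootTerm

theorem exists_wellOrder_of_height {Y : Type v} (ht : Y → ℕ) :
    ∃ (_ : LinearOrder Y) (_ : WellFoundedLT Y), ∀ y z : Y, ht y < ht z → y < z := by
  classical
  let _ : LinearOrder Y := linearOrderOfSTO WellOrderingRel
  have hwf : WellFoundedLT Y := ⟨WellOrderingRel.isWellOrder.wf⟩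
  let φ : Y → ℕ ×ₗ Y := fun y => toLex (ht y, y)
  have hφ : Function.Injective φ := fun y z h => by
    have := congrArg (fun p => (ofLex p).2) h
    exact this
  refine ⟨LinearOrder.lift' φ hφ, ?_, ?_⟩
  · constructor
    exact InvImage.wf φ (wellFounded_lt (α := ℕ ×ₗ Y))
  · intro y z h
    exact Prod.Lex.toLex_lt_toLex.2 (Or.inl h)

/-- Every module embeds in an `s`-divisible module so that the cokernel has a filtration with
factors embedding in `R ⧸ (s)`. -/
theorem exists_divisible_extension {R : Type v} [CommRing R] {s : R} (hs : IsRegular s)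
    (G : Type v) [AddCommGroup G] [Module R G] :
    ∃ (M Q : Type v) (_ : AddCommGroup M) (_ : Module R M) (_ : AddCommGroup Q) (_ : Module R Q)
      (ι : G →ₗ[R] M) (π : M →ₗ[R] Q) (Y : Type v) (_ : LinearOrder Y) (_ : WellFoundedLT Y)
      (A : Y → Submodule R Q), Function.Injective ι ∧ (∀ m, π m = 0 → ∃ g, ι g = m) ∧
        (∀ g, π (ι g) = 0) ∧ IsElementDivisible s M ∧ CyclicFiltration s A := by
  classical
  let Y := RootTerm R G
  obtain ⟨_, _, hlt⟩ := exists_wellOrder_of_height (RootTerm.height (R := R) (G := G))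
  have hval : ∀ y z : Y, y.val.2 z ≠ 0 → z < y := fun y z h =>
    hlt _ _ (RootTerm.height_lt_of_mem_support h)
  -- The relations state that s times the basis vector at `y` is the value of `y`.
  let D : (Y →₀ R) →ₗ[R] G × (Y →₀ R) :=
    Finsupp.linearCombination R fun y => (0, Finsupp.single y s) - y.val
  let D₂ : (Y →₀ R) →ₗ[R] (Y →₀ R) := LinearMap.snd R G (Y →₀ R) ∘ₗ D
  have hD₂ : ∀ y r, D₂ (Finsupp.single y r) = r • (Finsupp.single y s - y.val.2) := by
    intro y r
    simp [D₂, D]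
  -- `D₂` is triangular with `s` on the diagonal. As `s` is regular, `D₂` is injective and preserves
  -- leading positions.
  have htop : ∀ (c : Y →₀ R) (m : Y), (∀ z ∈ c.support, z ≤ m) → D₂ c m = s * c m := by
    intro c m hm
    rw [← Finsupp.sum_single c, map_finsuppSum, Finsupp.sum_single, Finsupp.sum,
      Finsupp.finsetSum_apply, Finset.sum_eq_single m]
    · have : m.val.2 m = 0 := by
        by_contra h
        exact lt_irrefl _ (hval _ _ h)
      simp [hD₂, this, mul_comm]
    · intro z hz hzm
      have : z.val.2 m = 0 := by
        by_contra h
        exact (hval _ _ h).not_ge (hm z hz)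
      simp [hD₂, this, hzm]
    · intro h
      simp [Finsupp.notMem_support_iff.1 h]
  have hsupp : ∀ (c : Y →₀ R) (y : Y), D₂ c ∈ Finsupp.supported R R (Set.Iic y) →
      ∀ z ∈ c.support, z ≤ y := by
    intro c y hc z hz
    have hne : c.support.Nonempty := ⟨z, hz⟩
    have h1 := htop c (c.support.max' hne) fun z hz => c.support.le_max' z hz
    have h2 : D₂ c (c.support.max' hne) ≠ 0 := by
      rw [h1]
      intro h0
      have := hs.left.mul_left_eq_zero_iff.1 h0
      exact Finsupp.mem_support_iff.1 (c.support.max'_mem hne) this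
    exact (c.support.le_max' z hz).trans (hc (Finsupp.mem_support_iff.2 h2))
  have hD₂inj : ∀ c, D₂ c = 0 → c = 0 := by
    intro c hc
    by_contra hne
    have hne := Finsupp.support_nonempty_iff.2 hne
    have h1 := htop c (c.support.max' hne) fun z hz => c.support.le_max' z hz
    rw [hc] at h1
    have := hs.left.mul_left_eq_zero_iff.1 h1.symm
    exact Finsupp.mem_support_iff.1 (c.support.max'_mem hne) this
  let M := (G × (Y →₀ R)) ⧸ LinearMap.range D
  let Q := (Y →₀ R) ⧸ LinearMap.range D₂
  let q : (Y →₀ R) →ₗ[R] Q := (LinearMap.range D₂).mkQ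
  have hq : ∀ x, q x = 0 ↔ ∃ c, D₂ c = x := fun x => by
    rw [← LinearMap.mem_ker, Submodule.ker_mkQ]
    rfl
  let μ : G × (Y →₀ R) →ₗ[R] M := (LinearMap.range D).mkQ
  have hμ : ∀ x, μ x = 0 ↔ ∃ c, D c = x := fun x => by
    rw [← LinearMap.mem_ker, Submodule.ker_mkQ]
    rfl
  let π : M →ₗ[R] Q := (LinearMap.range D).liftQ (q ∘ₗ LinearMap.snd R G (Y →₀ R)) (by
    rintro _ ⟨c, rfl⟩
    rw [LinearMap.mem_ker, LinearMap.comp_apply, hq]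
    exact ⟨c, rfl⟩)
  have hπ : ∀ x, π (μ x) = q x.2 := fun x => rfl
  let A : Y → Submodule R Q := fun y => (Finsupp.supported R R (Set.Iic y)).map q
  refine ⟨M, Q, inferInstance, inferInstance, inferInstance, inferInstance,
    μ ∘ₗ LinearMap.inl R G (Y →₀ R), π, Y, ‹_›, ‹_›, A, ?_, ?_, ?_, ?_, ?_, ?_, ?_⟩
  · rw [injective_iff_map_eq_zero]
    intro g hg
    obtain ⟨c, hc⟩ := (hμ _).1 hg
    have h0 : c = 0 := hD₂inj c (by simp [D₂, hc])
    rw [h0, map_zero] at hc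
    exact (congrArg Prod.fst hc).symm
  · intro m hm
    obtain ⟨⟨g, x⟩, rfl⟩ := (LinearMap.range D).mkQ_surjective m
    obtain ⟨c, hc⟩ := (hq _).1 ((hπ (g, x)).symm.trans hm)
    refine ⟨g - (D c).1, ?_⟩
    have : μ (D c) = 0 := (hμ _).2 ⟨c, rfl⟩
    rw [LinearMap.comp_apply, ← sub_eq_zero]
    change _ - μ (g, x) = 0
    rw [← map_sub, ← neg_eq_zero, ← map_neg, ← this]
    congr 1
    ext1
    · simp
    · simp only [D₂, LinearMap.comp_apply, LinearMap.snd_apply] at hc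
      simp [hc]
  · intro g
    exact map_zero q
  · intro m
    obtain ⟨x, rfl⟩ := (LinearMap.range D).mkQ_surjective m
    obtain ⟨y, rfl⟩ := RootTerm.val_surjective x
    refine ⟨μ (0, Finsupp.single y 1), ?_⟩
    change s • μ _ = μ _
    rw [← map_smul, ← sub_eq_zero, ← map_sub, hμ]
    exact ⟨Finsupp.single y 1, by simp [D]⟩
  · intro y z h
    exact Submodule.map_mono (Finsupp.supported_mono (Set.Iic_subset_Iic.2 h))
  · intro x
    obtain ⟨c, rfl⟩ := (LinearMap.range D₂).mkQ_surjective x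
    have : Nonempty Y := ⟨RootTerm.of 0⟩
    obtain ⟨γ, hγ⟩ := exists_Iic_of_supported (R := R) c
    exact ⟨γ, c, hγ, rfl⟩
  · intro y
    let B : Submodule R Q := (Finsupp.supported R R (Set.Iio y)).map q
    have hmk : ∀ x, B.mkQ (q x) = 0 ↔ ∃ c, ∃ x' ∈ Finsupp.supported R R (Set.Iio y), x = x' + D₂ c := by
      intro x
      rw [← LinearMap.mem_ker, B.ker_mkQ]
      constructor
      · rintro ⟨x', hx', h⟩
        have : q (x - x') = 0 := by rw [map_sub, h, sub_self]
        obtain ⟨c, hc⟩ := (hq _).1 this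
        exact ⟨c, x', hx', by rw [hc]; abel⟩
      · rintro ⟨c, x', hx', rfl⟩
        refine ⟨x', hx', ?_⟩
        rw [map_add, (hq (D₂ c)).2 ⟨c, rfl⟩, add_zero]
    let e : R →ₗ[R] Q ⧸ B := B.mkQ ∘ₗ q ∘ₗ Finsupp.lsingle y
    -- By triangularity, a multiple of the basis vector at `y` falls into earlier stages only if its
    -- coefficient is divisible by `s`; so the factor at `y` is R/(s).
    have he : ∀ r, e r = 0 ↔ ∃ r', r = s * r' := by
      intro r
      refine (hmk _).trans ⟨?_, ?_⟩
      · rintro ⟨c, x', hx', h⟩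
        have h1 : D₂ c = Finsupp.single y r - x' := by rw [← Finsupp.lsingle_apply (R := R), h]; abel
        have h2 : D₂ c ∈ Finsupp.supported R R (Set.Iic y) := by
          rw [h1]
          exact sub_mem (Finsupp.single_mem_supported _ _ (Set.mem_Iic.2 le_rfl))
            (Finsupp.supported_mono Set.Iio_subset_Iic_self hx')
        have h3 := htop c y (hsupp c y h2)
        have h4 : x' y = 0 := by
          by_contra h
          exact lt_irrefl y (hx' (Finsupp.mem_support_iff.2 h))
        rw [h1, Finsupp.sub_apply, h4, Finsupp.single_eq_same, sub_zero] at h3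
        exact ⟨_, h3⟩
      · rintro ⟨r', rfl⟩
        refine ⟨Finsupp.single y r', r' • y.val.2, ?_, ?_⟩
        · exact Submodule.smul_mem _ _ fun z hz => hval _ _ (Finsupp.mem_support_iff.1 hz)
        · rw [hD₂, smul_sub, Finsupp.smul_single, smul_eq_mul, mul_comm r' s]
          simp
    refine ⟨B, fun x => ?_, (Ideal.span {s}).liftQ e ?_, ?_, ?_⟩
    · constructor
      · rintro ⟨c, hc, rfl⟩
        by_cases h0 : c = 0
        · left; rw [h0, map_zero]
        · have hne := Finsupp.support_nonempty_iff.2 h0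
          exact Or.inr ⟨c.support.max' hne, hc (c.support.max'_mem hne), c,
            fun z hz => c.support.le_max' z hz, rfl⟩
      · rintro (rfl | ⟨z, hz, c, hc, rfl⟩)
        · exact zero_mem _
        · exact ⟨c, Finsupp.supported_mono (Set.Iic_subset_Iio.2 hz) hc, rfl⟩
    · intro r hr
      obtain ⟨r', hr'⟩ := Ideal.mem_span_singleton'.1 hr
      exact (he r).2 ⟨r', by rw [← hr', mul_comm]⟩
    · rw [← LinearMap.ker_eq_bot, Submodule.ker_liftQ_eq_bot']
      ext r
      rw [LinearMap.mem_ker, he, Ideal.mem_span_singleton]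
      rfl
    · rintro _ ⟨c, hc, rfl⟩
      refine ⟨Submodule.Quotient.mk (c y), ?_⟩
      rw [Submodule.liftQ_apply, ← sub_eq_zero]
      change B.mkQ (q (Finsupp.single y (c y))) - _ = 0
      rw [← map_sub, ← map_sub, hmk]
      refine ⟨0, Finsupp.single y (c y) - c, ?_, by simp⟩
      intro z hz
      have hz := Finsupp.mem_support_iff.1 hz
      rw [Finsupp.sub_apply] at hz
      by_cases hzy : z = y
      · subst hzy; simp at hz
      · rw [Finsupp.single_eq_of_ne hzy, zero_sub, neg_ne_zero] at hz
        exact lt_of_le_of_ne (hc (Finsupp.mem_support_iff.2 hz)) hzy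

end Divisible

/-! ### Lifting countably presented flat modules -/

section Lift

/-- The composite of the maps `c k, c (k + 1), …, c (k + d - 1)`. -/
noncomputable def iterComp {R V : Type*} [Semiring R] [AddCommMonoid V] [Module R V] (c : ℕ → V →ₗ[R] V) :
    ℕ → ℕ → V →ₗ[R] V
  | _, 0 => LinearMap.id
  | k, d + 1 => iterComp c (k + 1) d ∘ₗ c k

section Sequence

variable {S N I J : Type*} [CommRing S] [AddCommGroup N] [Module S N]

/-- By flatness, `p` restricted to the finitely many coordinates involved factors through a finite
free module in which the relations `X` already vanish. That module is placed inside S^(ℕ) so that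
all stages share one module. -/
theorem exists_approximation [Flat S N] (p : (I →₀ S) →ₗ[S] N) (hp : Function.Surjective p)
    (X U : Finset (I →₀ S)) (hX : ∀ x ∈ X, p x = 0) :
    ∃ (a : (I →₀ S) →ₗ[S] (ℕ →₀ S)) (b : (ℕ →₀ S) →ₗ[S] (I →₀ S)) (W : Finset (I →₀ S)),
      (∀ x ∈ X, a x = 0) ∧ (∀ u ∈ U, p (b (a u)) = p u) ∧
        ∀ v, b v ∈ Submodule.span S (W : Set (I →₀ S)) := by
  classical
  let I₀ : Finset I := (X ∪ U).biUnion Finsupp.support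
  have hI₀ : ∀ x ∈ X ∪ U, x ∈ Finsupp.supported S S (I₀ : Set I) := fun x hx i hi =>
    Finset.mem_coe.2 (Finset.mem_biUnion.2 ⟨x, hx, hi⟩)
  let r : (I →₀ S) →ₗ[S] (I₀ →₀ S) := Finsupp.lcomapDomain Subtype.val Subtype.val_injective
  let i : (I₀ →₀ S) →ₗ[S] (I →₀ S) := Finsupp.lmapDomain S S Subtype.val
  have hir : ∀ x ∈ X ∪ U, i (r x) = x := fun x hx =>
    Finsupp.mapDomain_comapDomain _ Subtype.val_injective _ fun z hz => ⟨⟨z, hI₀ x hx hz⟩, rfl⟩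
  let rel : (X →₀ S) →ₗ[S] (I₀ →₀ S) := Finsupp.linearCombination S fun x : X => r x
  obtain ⟨k, a₀, y, hy, ha₀⟩ := Flat.exists_factorization_of_comp_eq_zero_of_free
    (f := rel) (x := p ∘ₗ i) (by
      ext x
      simp only [LinearMap.comp_apply, rel, Finsupp.lsingle_apply,
        Finsupp.linearCombination_single, one_smul, LinearMap.zero_apply]
      rw [hir _ (Finset.mem_union_left _ x.2), hX _ x.2])
  obtain ⟨b₀, hb₀⟩ := Module.projective_lifting_property p y hp
  let j : (Fin k →₀ S) →ₗ[S] (ℕ →₀ S) := Finsupp.lmapDomain S S Fin.val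
  let j' : (ℕ →₀ S) →ₗ[S] (Fin k →₀ S) := Finsupp.lcomapDomain Fin.val Fin.val_injective
  have hj : ∀ x, j' (j x) = x := fun x => Finsupp.comapDomain_mapDomain _ Fin.val_injective _
  refine ⟨j ∘ₗ a₀ ∘ₗ r, b₀ ∘ₗ j', Finset.univ.image fun l : Fin k => b₀ (Finsupp.single l 1),
    fun x hx => ?_, fun u hu => ?_, fun v => ?_⟩
  · have h1 := LinearMap.congr_fun ha₀ (Finsupp.single ⟨x, hx⟩ 1)
    simp only [LinearMap.comp_apply, rel, Finsupp.linearCombination_single, one_smul,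
      LinearMap.zero_apply] at h1
    simp [h1]
  · have h1 := LinearMap.congr_fun hy (r u)
    rw [LinearMap.comp_apply, hir u (Finset.mem_union_right _ hu)] at h1
    rw [h1, ← hb₀]
    simp [hj]
  · rw [LinearMap.comp_apply, ← Finsupp.sum_single (j' v), map_finsuppSum]
    refine Submodule.sum_mem _ fun l _ => ?_
    change b₀ (Finsupp.single l (j' v l)) ∈ _
    rw [← mul_one (j' v l), ← smul_eq_mul, ← Finsupp.smul_single, map_smul]
    exact Submodule.smul_mem _ _ (Submodule.subset_span (by simp))

theorem mem_span_seq {P : Type*} [AddCommGroup P] [Module S P] {X : ℕ → Finset P}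
    (hX : Monotone X) {Z : Set P} (hZ : ∀ z ∈ Z, ∃ k, z ∈ X k) {x : P}
    (hx : x ∈ Submodule.span S Z) : ∃ k, x ∈ Submodule.span S (X k : Set P) := by
  have hmono : Monotone fun k => Submodule.span S (X k : Set P) := fun k l h =>
    Submodule.span_mono (Finset.coe_subset.2 (hX h))
  rw [← Submodule.mem_iSup_of_directed _ hmono.directed_le]
  refine Submodule.span_le.2 (fun z hz => ?_) hx
  obtain ⟨k, hk⟩ := hZ z hz
  exact Submodule.mem_iSup_of_mem k (Submodule.subset_span hk)

theorem exists_seq_succ {α : Type*} (a : α) (f : ℕ → α → α) :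
    ∃ st : ℕ → α, ∀ k, st (k + 1) = f k (st k) :=
  ⟨fun k => Nat.rec a f k, fun _ => rfl⟩

/-- The approximations are iterated: `X` collects the given relations and the errors b(a u) − u, to
be killed at later stages; `U` collects the generators and the images of earlier stages. -/
theorem exists_approximation_sequence [Flat S N] (p : (I →₀ S) →ₗ[S] N)
    (hp : Function.Surjective p) (gen rel : ℕ → (I →₀ S)) (hprel : ∀ k, p (rel k) = 0) :
    ∃ (a : ℕ → (I →₀ S) →ₗ[S] (ℕ →₀ S)) (b : ℕ → (ℕ →₀ S) →ₗ[S] (I →₀ S))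
      (X U : ℕ → Finset (I →₀ S)), Monotone X ∧ Monotone U ∧ (∀ k, ∀ x ∈ X k, p x = 0) ∧
      (∀ k, ∀ x ∈ X k, a k x = 0) ∧ (∀ k, ∀ u ∈ U k, b k (a k u) - u ∈ X (k + 1)) ∧
      (∀ k v, b k v ∈ Submodule.span S (U (k + 1) : Set (I →₀ S))) ∧
      (∀ k, rel k ∈ X (k + 1)) ∧ ∀ k, gen k ∈ U (k + 1) := by
  classical
  choose a b W ha hb hW using fun t : {X : Finset (I →₀ S) // ∀ x ∈ X, p x = 0} ×
    Finset (I →₀ S) => exists_approximation p hp t.1.1 t.2 t.1.2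
  have hnext : ∀ (k : ℕ) (t : {X : Finset (I →₀ S) // ∀ x ∈ X, p x = 0} × Finset (I →₀ S)),
      ∀ x ∈ t.1.1 ∪ (t.2.image (fun u => b t (a t u) - u) ∪ {rel k}), p x = 0 := by
    intro k t x hx
    simp only [Finset.mem_union, Finset.mem_image, Finset.mem_singleton] at hx
    obtain hx | ⟨u, hu, rfl⟩ | rfl := hx
    · exact t.1.2 x hx
    · rw [map_sub, hb t u hu, sub_self]
    · exact hprel k
  obtain ⟨st, hst⟩ := exists_seq_succ
    (α := {X : Finset (I →₀ S) // ∀ x ∈ X, p x = 0} × Finset (I →₀ S)) (⟨∅, by simp⟩, ∅)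
    fun k t => (⟨_, hnext k t⟩, t.2 ∪ (W t ∪ {gen k}))
  have hX : ∀ k, (st (k + 1)).1.1 =
      (st k).1.1 ∪ ((st k).2.image (fun u => b (st k) (a (st k) u) - u) ∪ {rel k}) :=
    fun k => congrArg (fun t => t.1.1) (hst k)
  have hU : ∀ k, (st (k + 1)).2 = (st k).2 ∪ (W (st k) ∪ {gen k}) :=
    fun k => congrArg (fun t => t.2) (hst k)
  clear hst hnext
  refine ⟨fun k => a (st k), fun k => b (st k), fun k => (st k).1.1, fun k => (st k).2,
    monotone_nat_of_le_succ fun k => ?_, monotone_nat_of_le_succ fun k => ?_,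
    fun k => (st k).1.2, fun k => ha (st k), fun k u hu => ?_, fun k v => ?_, fun k => ?_,
    fun k => ?_⟩
  · rw [hX]; exact Finset.subset_union_left
  · rw [hU]; exact Finset.subset_union_left
  · beta_reduce
    rw [hX]
    exact Finset.mem_union_right _ (Finset.mem_union_left _ (Finset.mem_image.2 ⟨u, hu, rfl⟩))
  · beta_reduce
    rw [hU]
    exact Submodule.span_mono (Finset.coe_subset.2
      (Finset.subset_union_left.trans Finset.subset_union_right)) (hW (st k) v)
  · beta_reduce
    rw [hX]
    exact Finset.mem_union_right _ (Finset.mem_union_right _ (Finset.mem_singleton_self _))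
  · beta_reduce
    rw [hU]
    exact Finset.mem_union_right _ (Finset.mem_union_right _ (Finset.mem_singleton_self _))

/-- A countably presented flat module is the direct limit of a sequence of endomorphisms of the
free module of countable rank. -/
theorem exists_sequence [Flat S N] [Countable I] [Countable J] (g : (J →₀ S) →ₗ[S] (I →₀ S))
    (p : (I →₀ S) →ₗ[S] N) (hgp : Function.Exact g p) (hp : Function.Surjective p) :
    ∃ (c : ℕ → (ℕ →₀ S) →ₗ[S] (ℕ →₀ S)) (φ : ℕ → (ℕ →₀ S) →ₗ[S] N),
      (∀ k v, φ (k + 1) (c k v) = φ k v) ∧ (∀ x, ∃ k v, φ k v = x) ∧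
        ∀ k v, φ k v = 0 → ∃ d, iterComp c k d v = 0 := by
  obtain ⟨gen, hgen⟩ : ∃ gen : ℕ → (I →₀ S),
      insert 0 (Set.range fun i => Finsupp.single i 1) = Set.range gen :=
    ((Set.countable_range _).insert 0).exists_eq_range (Set.insert_nonempty _ _)
  obtain ⟨rel, hrel⟩ : ∃ rel : ℕ → (I →₀ S),
      insert 0 (Set.range fun j => g (Finsupp.single j 1)) = Set.range rel :=
    ((Set.countable_range _).insert 0).exists_eq_range (Set.insert_nonempty _ _)
  have hprel : ∀ k, p (rel k) = 0 := by
    intro k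
    have : rel k ∈ Set.range rel := ⟨k, rfl⟩
    rw [← hrel] at this
    obtain h | ⟨j, h⟩ := this
    · rw [h, map_zero]
    · rw [← h]; exact hgp.apply_apply_eq_zero _
  obtain ⟨a, b, X, U, hXm, hUm, hpX, haX, hba, hbU, hrelX, hgenU⟩ :=
    exists_approximation_sequence p hp gen rel hprel
  replace hpX : ∀ k, ∀ x ∈ Submodule.span S (X k : Set (I →₀ S)), p x = 0 := fun k x hx =>
    (Submodule.span_le (p := LinearMap.ker p)).2 (hpX k) hx
  replace haX : ∀ k l, k ≤ l → ∀ x ∈ Submodule.span S (X k : Set (I →₀ S)), a l x = 0 :=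
    fun k l hkl x hx => (Submodule.span_le (p := LinearMap.ker (a l))).2
      (fun x hx => haX l x (hXm hkl hx)) hx
  replace hba : ∀ k, ∀ u ∈ Submodule.span S (U k : Set (I →₀ S)),
      b k (a k u) - u ∈ Submodule.span S (X (k + 1) : Set (I →₀ S)) := by
    intro k u hu
    exact (Submodule.span_le (p := (Submodule.span S (X (k + 1) : Set (I →₀ S))).comap
      (b k ∘ₗ a k - LinearMap.id))).2 (fun u hu => Submodule.subset_span (hba k u hu)) hu
  have hpba : ∀ k, ∀ u ∈ Submodule.span S (U k : Set (I →₀ S)), p (b k (a k u)) = p u := by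
    intro k u hu
    have := hpX _ _ (hba k u hu)
    rwa [map_sub, sub_eq_zero] at this
  refine ⟨fun k => a (k + 1) ∘ₗ b k, fun k => p ∘ₗ b k, fun k v => hpba _ _ (hbU k v),
    fun x => ?_, fun k v hv => ?_⟩
  · obtain ⟨u, rfl⟩ := hp x
    have hu : u ∈ Submodule.span S (Set.range gen) := by
      rw [← hgen, ← Finsupp.sum_single u]
      refine Submodule.sum_mem _ fun i _ => ?_
      rw [← mul_one (u i), ← smul_eq_mul, ← Finsupp.smul_single]
      exact Submodule.smul_mem _ _ (Submodule.subset_span (Or.inr ⟨i, rfl⟩))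
    obtain ⟨k, hk⟩ := mem_span_seq hUm (Z := Set.range gen)
      (by rintro _ ⟨k, rfl⟩; exact ⟨k + 1, hgenU k⟩) hu
    exact ⟨k, a k u, hpba k u hk⟩
  · obtain ⟨w, hw⟩ := (hgp (b k v)).1 hv
    have hu : b k v ∈ Submodule.span S (Set.range rel) := by
      rw [← hw, ← hrel, ← Finsupp.sum_single w, map_finsuppSum]
      refine Submodule.sum_mem _ fun j _ => ?_
      change g (Finsupp.single j (w j)) ∈ _
      rw [← mul_one (w j), ← smul_eq_mul, ← Finsupp.smul_single, map_smul]
      exact Submodule.smul_mem _ _ (Submodule.subset_span (Or.inr ⟨j, rfl⟩))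
    obtain ⟨m, hm⟩ := mem_span_seq hXm (Z := Set.range rel)
      (by rintro _ ⟨k, rfl⟩; exact ⟨k + 1, hrelX k⟩) hu
    -- The composite telescopes: each inner b ∘ a changes its argument only by an element of some
    -- `X`, which all later `a` kill.
    have key : ∀ d k v, iterComp (fun k => a (k + 1) ∘ₗ b k) k (d + 1) v =
        a (k + d + 1) (b k v) := by
      intro d
      induction d with
      | zero => intro k v; rfl
      | succ d ih =>
        intro k v
        rw [iterComp, LinearMap.comp_apply, ih, LinearMap.comp_apply, ← sub_eq_zero,
          show k + 1 + d + 1 = k + (d + 1) + 1 by omega, ← map_sub]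
        exact haX (k + 2) _ (by omega) _ (hba (k + 1) _ (hbU k v))
    exact ⟨m + 1, by rw [key]; exact haX m _ (by omega) _ hm⟩

end Sequence

section Telescope

variable {R V : Type*} [CommRing R] [AddCommGroup V] [Module R V] (c : ℕ → V →ₗ[R] V)

/-- The relations defining the direct limit of the sequence `c`. -/
noncomputable def telescope : Submodule R (ℕ →₀ V) :=
  Submodule.span R {x | ∃ k v, x = Finsupp.single k v - Finsupp.single (k + 1) (c k v)}

theorem single_sub_single_iterComp_mem (d k : ℕ) (v : V) :
    Finsupp.single k v - Finsupp.single (k + d) (iterComp c k d v) ∈ telescope c := by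
  induction d generalizing k v with
  | zero => simp [iterComp]
  | succ d ih =>
    have h1 : Finsupp.single k v - Finsupp.single (k + 1) (c k v) ∈ telescope c :=
      Submodule.subset_span ⟨k, v, rfl⟩
    have h2 := add_mem h1 (ih (k + 1) (c k v))
    rw [sub_add_sub_cancel, show k + 1 + d = k + (d + 1) by omega] at h2
    exact h2

/-- Push the terms of index at most `m` to index `m`. -/
noncomputable def pushTo (m : ℕ) : (ℕ →₀ V) →ₗ[R] (ℕ →₀ V) :=
  Finsupp.lsum ℕ fun k =>
    if k ≤ m then Finsupp.lsingle m ∘ₗ iterComp c k (m - k) else Finsupp.lsingle k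

theorem sub_pushTo_mem (m : ℕ) (t : ℕ →₀ V) : t - pushTo c m t ∈ telescope c := by
  induction t using Finsupp.induction_linear with
  | zero => simp
  | add t t' h h' =>
    rw [map_add, add_sub_add_comm]
    exact add_mem h h'
  | single k v =>
    by_cases hk : k ≤ m
    · have := single_sub_single_iterComp_mem c (m - k) k v
      rw [Nat.add_sub_cancel' hk] at this
      simpa [pushTo, hk] using this
    · simp [pushTo, hk]

theorem exists_pushTo_eq_zero {x : ℕ →₀ V} (hx : x ∈ telescope c) :
    ∃ m₀, ∀ m ≥ m₀, pushTo c m x = 0 := by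
  induction hx using Submodule.span_induction with
  | mem x hx =>
    obtain ⟨k, v, rfl⟩ := hx
    refine ⟨k + 1, fun m hm => ?_⟩
    have h1 : k ≤ m := by omega
    have h2 : k + 1 ≤ m := hm
    have h3 : m - k = m - (k + 1) + 1 := by omega
    rw [map_sub, sub_eq_zero]
    simp [pushTo, h1, h2, h3, iterComp]
  | zero => exact ⟨0, fun _ _ => map_zero _⟩
  | add x y _ _ hx hy =>
    obtain ⟨m, hm⟩ := hx
    obtain ⟨m', hm'⟩ := hy
    refine ⟨max m m', fun l hl => ?_⟩
    rw [map_add, hm l (le_of_max_le_left hl), hm' l (le_of_max_le_right hl), add_zero]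
  | smul r x _ hx =>
    obtain ⟨m, hm⟩ := hx
    exact ⟨m, fun l hl => by rw [map_smul, hm l hl, smul_zero]⟩

/-- `pushTo` at a late index kills the given combination; being linear and the identity modulo the
relations, it can be subtracted termwise. -/
theorem isPureSub_telescope : IsPureSub (telescope c) := by
  intro n r x hx
  obtain ⟨m, hm⟩ := exists_pushTo_eq_zero c hx
  refine ⟨fun i => x i - pushTo c m (x i), fun i => sub_pushTo_mem c m _, ?_⟩
  have := hm m le_rfl
  simp only [map_sum, map_smul] at this
  simp [smul_sub, this]

theorem exists_sub_single_mem (t : ℕ →₀ V) : ∃ m v, t - Finsupp.single m v ∈ telescope c := by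
  induction t using Finsupp.induction_linear with
  | zero => exact ⟨0, 0, by simp⟩
  | single k v => exact ⟨k, v, by simp⟩
  | add t t' h h' =>
    obtain ⟨m, v, h⟩ := h
    obtain ⟨m', v', h'⟩ := h'
    have h1 := single_sub_single_iterComp_mem c m' m v
    have h2 := single_sub_single_iterComp_mem c m m' v'
    rw [add_comm m' m] at h2
    refine ⟨m + m', iterComp c m m' v + iterComp c m' m v', ?_⟩
    have := add_mem (add_mem h h1) (add_mem h' h2)
    rw [Finsupp.single_add]
    convert this using 1
    abel

end Telescope

/-- Countably presented flat modules over `R ⧸ (s)` lift to flat modules over `R`. -/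
theorem exists_flat_lift {R : Type*} [CommRing R] (s : R) {N : Type*} [AddCommGroup N]
    [Module R N] [Module (R ⧸ Ideal.span {s}) N] [IsScalarTower R (R ⧸ Ideal.span {s}) N]
    [Flat (R ⧸ Ideal.span {s}) N] {I J : Type*} [Countable I] [Countable J]
    (g : (J →₀ R ⧸ Ideal.span {s}) →ₗ[R ⧸ Ideal.span {s}] (I →₀ R ⧸ Ideal.span {s}))
    (p : (I →₀ R ⧸ Ideal.span {s}) →ₗ[R ⧸ Ideal.span {s}] N) (hgp : Function.Exact g p)
    (hp : Function.Surjective p) :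
    ∃ c : ℕ → (ℕ →₀ R) →ₗ[R] (ℕ →₀ R), ∃ ψ : ((ℕ →₀ (ℕ →₀ R)) ⧸ telescope c) →ₗ[R] N,
      Function.Surjective ψ ∧ ∀ x, ψ x = 0 → ∃ y, s • y = x := by
  classical
  obtain ⟨c, φ, hφ, hsurj, hker⟩ := exists_sequence g p hgp hp
  let red : (ℕ →₀ R) →ₗ[R] (ℕ →₀ R ⧸ Ideal.span {s}) :=
    Finsupp.mapRange.linearMap (Ideal.span {s}).mkQ
  have hred : Function.Surjective red :=
    Finsupp.mapRange_surjective _ (map_zero _) (Ideal.span {s}).mkQ_surjective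
  have hredker : ∀ v, red v = 0 → ∃ w, v = s • w := by
    intro v hv
    have h1 : ∀ i, ∃ r, v i = s * r := by
      intro i
      have h2 : (Ideal.span {s}).mkQ (v i) = 0 := DFunLike.congr_fun hv i
      rw [← LinearMap.mem_ker, Submodule.ker_mkQ] at h2
      exact Ideal.mem_span_singleton.1 h2
    choose r hr using h1
    refine ⟨Finsupp.onFinset v.support (fun i => if v i = 0 then 0 else r i) ?_, ?_⟩
    · intro i hi
      rw [Finsupp.mem_support_iff]
      intro h
      simp [h] at hi
    · ext i
      by_cases h : v i = 0
      · simp [h]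
      · simpa [h] using hr i
  -- Free modules are projective, so the transition maps lift to R; no compatibility between the
  -- lifts is needed for a sequence.
  choose c' hc' using fun k => Module.projective_lifting_property red
    ((c k).restrictScalars R ∘ₗ red) hred
  have hcr : ∀ k v, red (c' k v) = c k (red v) := fun k v => LinearMap.congr_fun (hc' k) v
  have hiter : ∀ d k v, red (iterComp c' k d v) = iterComp c k d (red v) := by
    intro d
    induction d with
    | zero => intro k v; rfl
    | succ d ih => intro k v; simp [iterComp, ih, hcr]
  let Ψ : (ℕ →₀ (ℕ →₀ R)) →ₗ[R] N := Finsupp.lsum ℕ fun k => (φ k).restrictScalars R ∘ₗ red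
  have hΨ : ∀ k v, Ψ (Finsupp.single k v) = φ k (red v) := fun k v => by simp [Ψ]
  have hΨ0 : telescope c' ≤ LinearMap.ker Ψ := by
    refine Submodule.span_le.2 ?_
    rintro _ ⟨k, v, rfl⟩
    rw [SetLike.mem_coe, LinearMap.mem_ker, map_sub, hΨ, hΨ, hcr, hφ, sub_self]
  refine ⟨c', (telescope c').liftQ Ψ hΨ0, fun x => ?_, fun x hx => ?_⟩
  · obtain ⟨k, v, rfl⟩ := hsurj x
    obtain ⟨v, rfl⟩ := hred v
    exact ⟨(telescope c').mkQ (Finsupp.single k v), hΨ k v⟩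
  · obtain ⟨t, rfl⟩ := (telescope c').mkQ_surjective x
    obtain ⟨m, v, htv⟩ := exists_sub_single_mem c' t
    have hv : φ m (red v) = 0 := by
      have h1 : Ψ (t - Finsupp.single m v) = 0 := hΨ0 htv
      have h2 : Ψ t = 0 := hx
      have h3 := map_sub Ψ t (Finsupp.single m v)
      rwa [h1, h2, hΨ, zero_sub, eq_comm, neg_eq_zero] at h3
    -- An element mapping to 0 becomes 0 modulo `s` at a later stage, hence is `s` times an element
    -- there.
    obtain ⟨d, hd⟩ := hker m _ hv
    rw [← hiter] at hd
    obtain ⟨w, hw⟩ := hredker _ hd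
    have h3 := add_mem htv (single_sub_single_iterComp_mem c' d m v)
    rw [sub_add_sub_cancel, hw, ← Finsupp.smul_single] at h3
    refine ⟨(telescope c').mkQ (Finsupp.single (m + d) w), ?_⟩
    rw [← map_smul, eq_comm, ← sub_eq_zero, ← map_sub, ← LinearMap.mem_ker, Submodule.ker_mkQ]
    exact h3

end Lift

/-! ### The main theorem -/

theorem theorem2p14 {R : Type u} [CommRing R] (s : R) (hs : IsRegular s)
    (h : DivisibleClosedUnderFlatCovers s) : PropertyP (R ⧸ Ideal.span {s}) := by
  intro N _ _ ⟨I, J, _, _, g, p, hgp, hp⟩ hflat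
  let _ : Module R N := Module.compHom N (Ideal.Quotient.mk (Ideal.span {s}))
  have : IsScalarTower R (R ⧸ Ideal.span {s}) N := IsScalarTower.of_algebraMap_smul fun _ _ => rfl
  obtain ⟨c, ψ, hψ, hψs⟩ := exists_flat_lift s g p hgp hp
  have : Flat R (ℕ →₀ (ℕ →₀ R)) := flat_finsupp ℕ
  have hG := flat_quotient_of_isPureSub (isPureSub_telescope c)
  obtain ⟨M, Q, _, _, _, _, ι, π, Y, _, _, A, hι, hπ, hπι, hM, hA⟩ :=
    exists_divisible_extension hs ((ℕ →₀ (ℕ →₀ R)) ⧸ telescope c)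
  obtain ⟨F, _, _, f, hf⟩ := exists_isFlatCover (R := R) M
  have hF := h F M f hf hM
  have := hf.flat
  obtain ⟨e, he⟩ := hf.exists_factorization _ ι
  have he' : ∀ x, f (e x) = ι x := LinearMap.congr_fun he
  have hinj : Function.Injective (LinearMap.lsmul R F s) := by
    -- Flatness makes `s` injective on `F`; surjectivity comes from the closure hypothesis.
    have := Flat.isSMulRegular_of_isRegular (M := F) hs
    exact this
  let E : F ≃ₗ[R] F := LinearEquiv.ofBijective (LinearMap.lsmul R F s) ⟨hinj, hF⟩
  have hE : ∀ x, s • E.symm x = x := fun x => E.apply_symm_apply x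
  -- Division by `s` takes place in `F`, where it is unique; the result is read in M/G.
  let θ := π ∘ₗ f ∘ₗ E.symm.toLinearMap ∘ₗ e
  have hθ : ∀ x, s • f (E.symm (e x)) = ι x := fun x => by rw [← map_smul, hE, he']
  have hsN : ∀ x : N, s • x = 0 := fun x => by
    have : Ideal.Quotient.mk (Ideal.span {s}) s = 0 :=
      Ideal.Quotient.eq_zero_iff_mem.2 (Ideal.mem_span_singleton_self s)
    change Ideal.Quotient.mk (Ideal.span {s}) s • x = 0
    rw [this, zero_smul]
  -- `θ` vanishes on sG, since dividing e(s y) by `s` returns e y, which lies over ι y.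
  obtain ⟨η, hη⟩ := exists_comp_eq_of_ker_le ψ hψ θ (by
    intro x hx
    obtain ⟨y, rfl⟩ := hψs x hx
    have h1 : E.symm (e (s • y)) = e y := by
      rw [LinearEquiv.symm_apply_eq, map_smul]; rfl
    change π (f (E.symm (e (s • y)))) = 0
    rw [h1, he', hπι])
  refine hA.isFilteredByIdeals η ?_
  rw [injective_iff_map_eq_zero]
  intro n hn
  obtain ⟨x, rfl⟩ := hψ n
  rw [hη] at hn
  -- If the quotient by `s` lies in `G`, say at `y`, then x = s y, which is zero in `N`.
  obtain ⟨y, hy⟩ := hπ _ hn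
  have h1 := hθ x
  change s • f (E.symm (e x)) = _ at h1
  have h2 : ι (s • y) = ι x := by
    rw [map_smul, hy]; exact h1
  rw [← hι h2, map_smul, hsN]
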